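/- Let $G$ be a connected simple real Lie group with trivial center and of real rank one, let $K\le G$ be a maximal compact subgroup, let $X=G/K$ be the associated symmetric space, and let $n=\dim X$. Assume $n\ge 4$. Call an element $g\in G$ unipotent if $\mathrm{Ad}(g)-1$ is a nilpotent endomorphism of the Lie algebra of $G$, and call a subgroup of $G$ unipotent if all its elements are unipotent. Let $B\le G$ be a connected abelian Lie subgroup (not necessarily closed). If $B$ is not unipotent, then $\dim B<n-1$. -/

import Mathlib

open scoped Manifold ContDiff

universe u

/-- Over `ℝ` the order of smoothness Mathlib asks for to form the Lie algebra is `3`, so a smooth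
Lie group has a Lie algebra. -/
instance minSmoothness_real_three_leInfty : ENat.LEInfty (minSmoothness ℝ 3) :=
  ⟨by rw [minSmoothness_of_isRCLikeNormedField]; exact ENat.LEInfty.out⟩

noncomputable section

namespace RankOne

variable {m : ℕ} {G : Type u} [Group G] [TopologicalSpace G]
  [ChartedSpace (EuclideanSpace ℝ (Fin m)) G] [LieGroup (𝓡 m) ∞ G]

variable (m G) in
/-- The Lie algebra `𝔤 = T₁G` of an `m`-dimensional real Lie group `G`. -/
abbrev LieAlg : Type := GroupLieAlgebra (𝓡 m) G

variable (m) in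
/-- The adjoint action `Ad g : 𝔤 → 𝔤`, the derivative at `1` of the conjugation
`x ↦ g * x * g⁻¹`. (The derivative takes values in the tangent space at `g * 1 * g⁻¹ = 1`.) -/
def Ad (g : G) : LieAlg m G →L[ℝ] LieAlg m G :=
  mfderiv (𝓡 m) (𝓡 m) (fun x : G => g * x * g⁻¹) (1 : G)

theorem mdifferentiableAt_conj (g : G) :
    MDifferentiableAt (𝓡 m) (𝓡 m) (fun x : G => g * x * g⁻¹) (1 : G) := by
  have h : ContMDiff (𝓡 m) (𝓡 m) ∞ (fun x : G => g * x * g⁻¹) :=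
    (contMDiff_const.mul contMDiff_id).mul contMDiff_const
  exact h.mdifferentiable (by simp) 1

theorem Ad_one : Ad m (1 : G) = ContinuousLinearMap.id ℝ (LieAlg m G) := by
  have h : (fun x : G => (1 : G) * x * (1 : G)⁻¹) = id := by
    funext x; simp
  unfold Ad
  rw [h]
  exact mfderiv_id

theorem Ad_mul (g h : G) : Ad m (g * h) = (Ad m g).comp (Ad m h) := by
  have e : (fun x : G => (g * h) * x * (g * h)⁻¹) =
      (fun x : G => g * x * g⁻¹) ∘ (fun x : G => h * x * h⁻¹) := by
    funext x; simp [mul_assoc]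
  have h1 : h * 1 * h⁻¹ = (1 : G) := by simp
  have hg : MDifferentiableAt (𝓡 m) (𝓡 m) (fun x : G => g * x * g⁻¹) (h * 1 * h⁻¹) := by
    rw [h1]; exact mdifferentiableAt_conj g
  have key := mfderiv_comp (I := 𝓡 m) (I' := 𝓡 m) (I'' := 𝓡 m) (1 : G) hg (mdifferentiableAt_conj h)
  unfold Ad
  rw [e]
  refine key.trans ?_
  congr 1
  have : ∀ y : G, y = 1 →
      (mfderiv (𝓡 m) (𝓡 m) (fun x : G => g * x * g⁻¹) y :
        EuclideanSpace ℝ (Fin m) →L[ℝ] EuclideanSpace ℝ (Fin m)) =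
      mfderiv (𝓡 m) (𝓡 m) (fun x : G => g * x * g⁻¹) (1 : G) := by
    rintro y rfl; rfl
  exact this _ h1

variable (m) in
/-- `g ∈ G` is unipotent if `Ad g` is a unipotent operator, i.e. `(Ad g - 1) ^ k = 0` for
some `k`. -/
def IsUnipotentElement (g : G) : Prop :=
  IsNilpotent ((Ad m g : LieAlg m G →ₗ[ℝ] LieAlg m G) - 1 : Module.End ℝ (LieAlg m G))

variable (m) in
/-- A subgroup is unipotent if all its elements are. -/
def IsUnipotentSubgroup (B : Subgroup G) : Prop :=
  ∀ b ∈ B, IsUnipotentElement m b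

/-- A Cartan involution of the Lie algebra `𝔤`: an involutive automorphism `θ` of `𝔤` such that
`(x, y) ↦ - κ (x, θ y)` is positive definite, where `κ` is the Killing form. -/
structure IsCartanInvolution (θ : LieAlg m G ≃ₗ⁅ℝ⁆ LieAlg m G) : Prop where
  involutive : ∀ x, θ (θ x) = x
  pos : ∀ x, x ≠ 0 → 0 < - killingForm ℝ (LieAlg m G) x (θ x)

/-- The `(-1)`-eigenspace `𝔭` in the Cartan decomposition `𝔤 = 𝔨 ⊕ 𝔭`. -/
def cartanP (θ : LieAlg m G ≃ₗ⁅ℝ⁆ LieAlg m G) : Submodule ℝ (LieAlg m G) where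
  carrier := {x | θ x = -x}
  add_mem' := by
    intro x y hx hy
    simp only [Set.mem_ofPred_eq] at hx hy ⊢
    rw [map_add, hx, hy, neg_add]
  zero_mem' := by simp
  smul_mem' := by
    intro c x hx
    simp only [Set.mem_ofPred_eq] at hx ⊢
    rw [map_smul, hx, smul_neg]

/-- The real rank of `G`: the largest dimension of an abelian subspace of `𝔭`. -/
def realRank (θ : LieAlg m G ≃ₗ⁅ℝ⁆ LieAlg m G) : ℕ :=
  sSup {r : ℕ | ∃ A : Submodule ℝ (LieAlg m G), A ≤ cartanP θ ∧
    (∀ x ∈ A, ∀ y ∈ A, ⁅x, y⁆ = 0) ∧ Module.finrank ℝ A = r}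

/-- The subgroup `K = {g ∈ G | Ad g ∘ θ = θ ∘ Ad g}` of `G`. When `G` is connected semisimple
with trivial center and `θ` is a Cartan involution, this is the maximal compact subgroup of `G`
attached to `θ` (its Lie algebra is the fixed space of `θ`). -/
def maxCompact (θ : LieAlg m G ≃ₗ⁅ℝ⁆ LieAlg m G) : Subgroup G where
  carrier := {g | ∀ x, Ad m g (θ x) = θ (Ad m g x)}
  one_mem' := by
    intro x
    rw [Ad_one]
    rfl
  mul_mem' := by
    intro g h hg hh x
    simp only [Set.mem_ofPred_eq] at hg hh
    rw [Ad_mul, ContinuousLinearMap.comp_apply, ContinuousLinearMap.comp_apply, hh, hg]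
  inv_mem' := by
    intro g hg x
    simp only [Set.mem_ofPred_eq] at hg
    have h1 : ∀ y, Ad m g⁻¹ (Ad m g y) = y := by
      intro y
      rw [← ContinuousLinearMap.comp_apply, ← Ad_mul, inv_mul_cancel, Ad_one]
      rfl
    have h2 : ∀ y, Ad m g (Ad m g⁻¹ y) = y := by
      intro y
      rw [← ContinuousLinearMap.comp_apply, ← Ad_mul, mul_inv_cancel, Ad_one]
      rfl
    calc Ad m g⁻¹ (θ x) = Ad m g⁻¹ (θ (Ad m g (Ad m g⁻¹ x))) := by rw [h2]
      _ = Ad m g⁻¹ (Ad m g (θ (Ad m g⁻¹ x))) := by rw [hg]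
      _ = θ (Ad m g⁻¹ x) := h1 _

/-- `φ` is a one-parameter subgroup of `G` with velocity `v ∈ 𝔤` at time `0`, i.e.
`φ t = exp (t v)`. -/
structure IsOneParameterSubgroup (φ : ℝ → G) (v : LieAlg m G) : Prop where
  map_add : ∀ s t, φ (s + t) = φ s * φ t
  contMDiff : ContMDiff 𝓘(ℝ, ℝ) (𝓡 m) ∞ φ
  velocity : (show LieAlg m G from mfderiv 𝓘(ℝ, ℝ) (𝓡 m) φ 0 (1 : ℝ)) = v

variable (m) in
/-- The Lie algebra `{v ∈ 𝔤 | exp (t v) ∈ H for all t ∈ ℝ}` of a closed subgroup `H` of `G`, as a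
subspace of `𝔤` (the set is itself a subspace when `H` is closed). -/
def closedSubgroupLieAlg (H : Subgroup G) : Submodule ℝ (LieAlg m G) :=
  Submodule.span ℝ {v | ∃ φ : ℝ → G, IsOneParameterSubgroup φ v ∧ ∀ t, φ t ∈ H}

/-- The dimension of the symmetric space `X = G ⧸ K`, i.e. the dimension of its tangent space
`𝔤 ⧸ 𝔨` at the base point. -/
def symmetricSpaceDim (θ : LieAlg m G ≃ₗ⁅ℝ⁆ LieAlg m G) : ℕ :=
  Module.finrank ℝ (LieAlg m G ⧸ closedSubgroupLieAlg m (maxCompact θ))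

variable (m) in
/-- `B` is a connected Lie subgroup of `G` of dimension `d`: the image of a connected
`d`-dimensional Lie group under an injective immersive smooth homomorphism (`B` need not be
closed in `G`). -/
def IsConnectedLieSubgroup (B : Subgroup G) (d : ℕ) : Prop :=
  ∃ (L : Type u) (_ : Group L) (_ : TopologicalSpace L)
    (_ : ChartedSpace (EuclideanSpace ℝ (Fin d)) L) (_ : LieGroup (𝓡 d) ∞ L)
    (_ : ConnectedSpace L) (ι : L →* G),
    ContMDiff (𝓡 d) (𝓡 m) ∞ ι ∧ Function.Injective ι ∧
    (∀ x : L, Function.Injective (mfderiv (𝓡 d) (𝓡 m) ι x)) ∧ ι.range = B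

end RankOne

end

/-! The question is infinitesimal. Let 𝔟 be the image of the differential of the immersion at the
identity, an abelian subspace of 𝔤 of dimension d. If every element of 𝔟 were ad-nilpotent, B would
be unipotent: the derivative of tr Ad along B is the trace of Ad b composed with a commuting
nilpotent operator, hence 0, so tr Ad is constant on B. Applied to powers of b, this gives every
power of Ad b the trace of the identity, which forces Ad b - 1 to be nilpotent
(`isUnipotentElement_of_isNilpotent`). So 𝔟 has an element that is not ad-nilpotent, and then d ≤
max 2 (dim 𝔭 - 2) by `finrank_le_of_not_isNilpotent`. As dim 𝔭 ≤ n and n ≥ 4, this gives d ≤ n - 2.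

The bound comes from a Kempf–Ness argument. For a basis b_i of 𝔟 consider the energy p ↦ Σ ⟨exp(ad
p) b_i, b_i⟩ on 𝔭, where ⟨x, y⟩ = -κ(x, θ y). If the sublevel set through 0 is bounded, there is a
minimum p₀; after applying exp(ad p₀ / 2) the moment map Σ [b_i, θ b_i] vanishes, and then 𝔟
commutes with θ𝔟. If it is unbounded, a limit direction yields a nonzero q ∈ 𝔭 with 𝔟 inside the
parabolic 𝔷(q) + 𝔫, where 𝔫 is the sum of the positive eigenspaces of ad q.

Three facts drive the count. By rank one, 𝔷(q) consists of multiples of q plus θ-fixed elements. A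
faithful commuting family of skew operators has dimension at most half the codimension of its common
kernel. Finally dim 𝔫 + 1 ≤ dim 𝔭. In the balanced case they give 2d ≤ dim 𝔭 + 1. In the parabolic
case let C be the projection of 𝔟 to 𝔷(q). If C is θ-fixed, then 𝔟 ∩ 𝔫 is no larger than the
centralizer of C in 𝔫, so d ≤ dim 𝔫 - dim C, and C ≠ 0 because 𝔟 is not nilpotent. Otherwise some
element of C has a component along q and centralizes nothing nonzero in 𝔫, so 𝔟 ≅ C and 2d ≤ 2 + dim
𝔫. -/

section

open Module
open scoped InnerProductSpace

/-! ### Trace criterion for nilpotency -/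

/-- Over a field of characteristic zero, an endomorphism all of whose positive powers are traceless
is nilpotent. -/
theorem LinearMap.isNilpotent_of_forall_trace_pow_eq_zero {K V : Type*} [Field K] [CharZero K]
    [AddCommGroup V] [Module K V] [FiniteDimensional K V] (T : Module.End K V)
    (h : ∀ k, 1 ≤ k → LinearMap.trace K V (T ^ k) = 0) : IsNilpotent T := by
  classical
  have hne : T.charpoly ≠ 0 := (LinearMap.charpoly_monic T).ne_zero
  obtain ⟨k, q, hq, hq0⟩ : ∃ (k : ℕ) (q : Polynomial K),
      T.charpoly = Polynomial.X ^ k * q ∧ ¬ Polynomial.X ∣ q := by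
    obtain ⟨q, hq, hq0⟩ :=
      Polynomial.exists_eq_pow_rootMultiplicity_mul_and_not_dvd T.charpoly hne 0
    rw [Polynomial.C_0, sub_zero] at hq hq0
    exact ⟨_, q, hq, hq0⟩
  -- The exponent `k + 1` instead of `k` keeps the polynomial `e` below divisible by `X` even when
  -- `k = 0`, so its trace involves positive powers only.
  have hcop : IsCoprime ((Polynomial.X : Polynomial K) ^ (k + 1)) q :=
    ((Polynomial.prime_X.irreducible.coprime_iff_not_dvd).2 hq0).pow_left
  obtain ⟨a, b, hab⟩ := hcop
  have hkill : (Polynomial.aeval T) (Polynomial.X ^ (k + 1) * q) = 0 := by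
    have : (Polynomial.X ^ (k + 1) * q : Polynomial K) = Polynomial.X * T.charpoly := by
      rw [hq]; ring
    rw [this, map_mul, LinearMap.aeval_self_charpoly, mul_zero]
  -- By Bézout, `e(T)` is the projection onto the Fitting component on which `T` is invertible.
  obtain ⟨e, he⟩ : ∃ e : Polynomial K, e = a * Polynomial.X ^ (k + 1) := ⟨_, rfl⟩
  have hidem : IsIdempotentElem (Polynomial.aeval T e) := by
    have h1 : e * e = e - a * b * (Polynomial.X ^ (k + 1) * q) := by
      rw [he]
      linear_combination (a * Polynomial.X ^ (k + 1)) * hab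
    rw [IsIdempotentElem, ← map_mul, h1, map_sub, map_mul (Polynomial.aeval T) (a * b), hkill,
      mul_zero, sub_zero]
  have htr : LinearMap.trace K V (Polynomial.aeval T e) = 0 := by
    have : ∀ p : Polynomial K,
        LinearMap.trace K V (Polynomial.aeval T (p * Polynomial.X ^ (k + 1))) = 0 := by
      intro p
      induction p using Polynomial.induction_on' with
      | add p q hp hq => rw [add_mul, map_add, map_add, hp, hq, add_zero]
      | monomial n c =>
        rw [Polynomial.monomial_mul_X_pow, Polynomial.aeval_monomial,
          Algebra.algebraMap_eq_smul_one, smul_one_mul, map_smul, h _ (by omega), smul_zero]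
    rw [he]
    exact this a
  -- The trace of an idempotent is its rank, which characteristic zero lets one recover.
  have hid : ∀ P : Module.End K V, IsIdempotentElem P → LinearMap.trace K V P = 0 → P = 0 := by
    intro P hP htr
    have hp := LinearMap.IsIdempotentElem.isProj_range P hP
    rw [hp.trace, Nat.cast_eq_zero, Submodule.finrank_eq_zero] at htr
    exact LinearMap.range_eq_bot.1 htr
  have hzero : Polynomial.aeval T e = 0 := by
    exact hid _ hidem htr
  refine ⟨k + 1, ?_⟩
  have h2 : (Polynomial.aeval T) (Polynomial.X ^ (k + 1) : Polynomial K) =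
      Polynomial.aeval T (Polynomial.X ^ (k + 1) * e + b * (Polynomial.X ^ (k + 1) * q)) := by
    congr 1
    rw [he]
    linear_combination (-Polynomial.X ^ (k + 1)) * hab
  rw [map_add, map_mul, hzero, mul_zero, map_mul (Polynomial.aeval T) b, hkill, mul_zero,
    add_zero, map_pow, Polynomial.aeval_X] at h2
  exact h2


/-! ### Commuting families of skew-symmetric operators -/

section Skew

variable {V : Type*} [NormedAddCommGroup V] [InnerProductSpace ℝ V] [FiniteDimensional ℝ V]

/-- A faithful commuting family of skew-symmetric operators has a nonzero member `t` and a vector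
`w` such that the plane spanned by `w` and `t w` is stable under the family, which acts on it
by multiples of `t`. -/
theorem exists_skew_plane {C : Type*} [AddCommGroup C] [Module ℝ C] (ρ : C →ₗ[ℝ] V →ₗ[ℝ] V)
    (hskew : ∀ c x y, ⟪ρ c x, y⟫_ℝ = -⟪x, ρ c y⟫_ℝ)
    (hcomm : ∀ c d x, ρ c (ρ d x) = ρ d (ρ c x)) (c₀ : C) (hc₀ : ρ c₀ ≠ 0) :
    ∃ w : V, ρ c₀ w ≠ 0 ∧ ∃ μ : C → ℝ,
      (∀ c, ρ c (ρ c₀ w) = μ c • w) ∧ (∀ c, μ c₀ • ρ c w = μ c • ρ c₀ w) := by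
  set t := ρ c₀ with ht
  -- A product of two commuting skew operators is symmetric, so the operators `ρ c ∘ t` are
  -- simultaneously diagonalizable over ℝ.
  have hsym : ∀ c, (ρ c ∘ₗ t).IsSymmetric := by
    intro c x y
    simp only [LinearMap.comp_apply]
    rw [hskew, hskew, neg_neg, hcomm]
  have hc : Pairwise (Function.onFun Commute fun c => ρ c ∘ₗ t) := by
    intro c d _
    ext x
    simp only [Module.End.mul_apply, LinearMap.comp_apply]
    rw [hcomm c₀ d, hcomm c d, hcomm c c₀]
  have htop := LinearMap.IsSymmetric.iSup_iInf_eq_top_of_commute hsym hc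
  by_contra hcon
  push Not at hcon
  have hle : (⊤ : Submodule ℝ V) ≤ LinearMap.ker t := by
    rw [← htop]
    refine iSup_le fun χ => ?_
    intro w hw
    simp only [Submodule.mem_iInf, Module.End.mem_eigenspace_iff, LinearMap.comp_apply] at hw
    by_contra htw
    obtain ⟨c, hcc⟩ := hcon w htw χ hw
    apply hcc
    -- Evaluating `ρ c (t (t w))` in two orders yields the second relation of the conclusion with `μ
    -- = χ`.
    have h1 : ρ c (t (t w)) = χ c • t w := by rw [hcomm c c₀, hw, map_smul]
    have h2 : ρ c (t (t w)) = χ c₀ • ρ c w := by rw [ht, ← ht, hw c₀, map_smul]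
    rw [← h2, h1]
  apply hc₀
  ext x
  exact hle (Submodule.mem_top : x ∈ ⊤)

/-- A faithful commuting family of skew-symmetric operators has dimension at most half the
codimension of its common kernel. -/
theorem two_mul_finrank_add_finrank_ker_le_of_skew (n : ℕ) :
    ∀ {V : Type*} [NormedAddCommGroup V] [InnerProductSpace ℝ V] [FiniteDimensional ℝ V]
      {C : Type*} [AddCommGroup C] [Module ℝ C] [FiniteDimensional ℝ C]
      (ρ : C →ₗ[ℝ] V →ₗ[ℝ] V) (_ : finrank ℝ C = n)
      (_ : ∀ c x y, ⟪ρ c x, y⟫_ℝ = -⟪x, ρ c y⟫_ℝ)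
      (_ : ∀ c d x, ρ c (ρ d x) = ρ d (ρ c x)) (_ : ∀ c, ρ c = 0 → c = 0),
      2 * n + finrank ℝ (⨅ c, LinearMap.ker (ρ c) : Submodule ℝ V) ≤ finrank ℝ V := by
  induction n with
  | zero =>
    intro V _ _ _ C _ _ _ ρ _ _ _ _
    simpa using Submodule.finrank_le _
  | succ n ih =>
    intro V _ _ _ C _ _ _ ρ hn hskew hcomm hinj
    have : Nontrivial C := Module.nontrivial_of_finrank_pos (R := ℝ) (by omega)
    obtain ⟨c₀, hc₀⟩ := exists_ne (0 : C)
    obtain ⟨w, hw, μ, hμ, hμ'⟩ := exists_skew_plane ρ hskew hcomm c₀ fun h => hc₀ (hinj _ h)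
    set t := ρ c₀ with ht
    have hww : ⟪w, t w⟫_ℝ = 0 := by
      have := hskew c₀ w w
      rw [real_inner_comm] at this
      linarith
    have hμ0 : μ c₀ ≠ 0 := by
      intro h0
      have h1 := hμ c₀
      rw [h0, zero_smul] at h1
      have h2 := hskew c₀ w (t w)
      rw [h1, inner_zero_right, neg_zero] at h2
      exact hw (inner_self_eq_zero.1 h2)
    have hw0 : w ≠ 0 := fun h => hw (by rw [h, map_zero])
    set W : Submodule ℝ V := Submodule.span ℝ {w, t w} with hW
    have hwW : w ∈ W := Submodule.subset_span (by simp)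
    have htwW : t w ∈ W := Submodule.subset_span (by simp)
    have hρw : ∀ c, ρ c w = (μ c / μ c₀) • t w := by
      intro c
      rw [div_eq_inv_mul, mul_smul, ← hμ' c, smul_smul, inv_mul_cancel₀ hμ0, one_smul]
    have hWinv : ∀ c, ∀ x ∈ W, ρ c x ∈ W := by
      intro c x hx
      obtain ⟨a, b, rfl⟩ := Submodule.mem_span_pair.1 hx
      rw [map_add, map_smul, map_smul, hμ, hρw]
      exact W.add_mem (W.smul_mem _ (W.smul_mem _ htwW)) (W.smul_mem _ (W.smul_mem _ hwW))
    have hWperp : ∀ c, ∀ x ∈ Wᗮ, ρ c x ∈ Wᗮ := by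
      intro c x hx
      rw [Submodule.mem_orthogonal] at hx ⊢
      intro u hu
      have := hskew c u x
      rw [hx _ (hWinv c u hu)] at this
      linarith
    have hWdim : finrank ℝ W = 2 := by
      have hli : LinearIndependent ℝ ![w, t w] := by
        rw [LinearIndependent.pair_iff]
        intro a b hab
        have h1 : ⟪w, a • w + b • t w⟫_ℝ = 0 := by rw [hab, inner_zero_right]
        have h2 : ⟪t w, a • w + b • t w⟫_ℝ = 0 := by rw [hab, inner_zero_right]
        rw [inner_add_right, inner_smul_right, inner_smul_right] at h1 h2
        rw [hww, mul_zero, add_zero] at h1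
        rw [real_inner_comm, hww, mul_zero, zero_add] at h2
        exact ⟨(mul_eq_zero.1 h1).resolve_right fun h => hw0 (inner_self_eq_zero.1 h),
          (mul_eq_zero.1 h2).resolve_right fun h => hw (inner_self_eq_zero.1 h)⟩
      have := finrank_span_eq_card hli
      rwa [Matrix.range_cons, Matrix.range_cons, Matrix.range_empty, Set.union_empty,
        Set.singleton_union, Fintype.card_fin] at this
    -- Evaluation at `t w` reads off the weight `μ`. Its kernel is the hyperplane of members
    -- vanishing on `W`, and the induction continues with this hyperplane acting on `Wᗮ`.
    let f : C →ₗ[ℝ] V := LinearMap.applyₗ (t w) ∘ₗ ρ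
    have hf : ∀ c, f c = μ c • w := hμ
    have hker : ∀ c, f c = 0 → ∀ x ∈ W, ρ c x = 0 := by
      intro c hc x hx
      have h0 : μ c = 0 := by
        rw [hf] at hc
        exact (smul_eq_zero.1 hc).resolve_right hw0
      obtain ⟨a, b, rfl⟩ := Submodule.mem_span_pair.1 hx
      rw [map_add, map_smul, map_smul, hμ, hρw, h0]
      simp
    have hrange : LinearMap.range f = Submodule.span ℝ {w} := by
      apply le_antisymm
      · rintro _ ⟨c, rfl⟩
        rw [hf]
        exact Submodule.smul_mem _ _ (Submodule.mem_span_singleton_self w)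
      · rw [Submodule.span_singleton_le_iff_mem]
        refine ⟨(μ c₀)⁻¹ • c₀, ?_⟩
        rw [map_smul, hf, smul_smul, inv_mul_cancel₀ hμ0, one_smul]
    have hCdim : finrank ℝ (LinearMap.ker f) = n := by
      have := LinearMap.finrank_range_add_finrank_ker f
      rw [hrange, finrank_span_singleton hw0] at this
      omega
    let ρ' : LinearMap.ker f →ₗ[ℝ] Wᗮ →ₗ[ℝ] Wᗮ :=
      { toFun := fun c => (ρ c).restrict (hWperp c)
        map_add' := by intro a b; ext x; simp
        map_smul' := by intro a b; ext x; simp }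
    have hρ' : ∀ c x, (ρ' c x : V) = ρ c x := fun c x => rfl
    have key := ih ρ' hCdim (fun c x y => hskew c x y)
      (fun c d x => Subtype.ext (hcomm c d x))
      (by
        intro c hc
        apply Subtype.ext
        apply hinj
        ext x
        have hx : x ∈ W ⊔ Wᗮ := by rw [Submodule.sup_orthogonal_of_hasOrthogonalProjection]; trivial
        obtain ⟨y, hy, z, hz, rfl⟩ := Submodule.mem_sup.1 hx
        have : ρ c z = 0 := by rw [← hρ' c ⟨z, hz⟩, hc]; rfl
        rw [map_add, hker c c.2 y hy, this]
        simp)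
    have hle : finrank ℝ (⨅ c, LinearMap.ker (ρ c) : Submodule ℝ V) ≤
        finrank ℝ (⨅ c, LinearMap.ker (ρ' c) : Submodule ℝ Wᗮ) := by
      -- Both `t w` and `w`, a multiple of `t (t w)`, lie in the range of the skew operator `t`,
      -- hence are orthogonal to its kernel. So the common kernel is not diminished in passing to
      -- `Wᗮ`.
      have hsub : (⨅ c, LinearMap.ker (ρ c) : Submodule ℝ V) ≤
          (⨅ c, LinearMap.ker (ρ' c) : Submodule ℝ Wᗮ).map Wᗮ.subtype := by
        intro x hx
        rw [Submodule.mem_iInf] at hx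
        have hxW : x ∈ Wᗮ := by
          rw [Submodule.mem_orthogonal]
          have htx : t x = 0 := hx c₀
          have h1 : ⟪t w, x⟫_ℝ = 0 := by rw [hskew, htx, inner_zero_right, neg_zero]
          have h2 : ⟪w, x⟫_ℝ = 0 := by
            have h3 : t (t w) = μ c₀ • w := hμ c₀
            have h4 := hskew c₀ (t w) x
            rw [h3, htx, inner_zero_right, neg_zero, inner_smul_left] at h4
            exact (mul_eq_zero.1 h4).resolve_left hμ0
          intro u hu
          obtain ⟨a, b, rfl⟩ := Submodule.mem_span_pair.1 hu
          rw [inner_add_left, inner_smul_left, inner_smul_left, h1, h2]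
          simp
        refine ⟨⟨x, hxW⟩, ?_, rfl⟩
        simp only [Submodule.coe_iInf, Set.mem_iInter, SetLike.mem_coe, LinearMap.mem_ker]
        intro c
        exact Subtype.ext (hx c)
      exact (Submodule.finrank_mono hsub).trans (Submodule.finrank_map_le _ _)
    have hsum := Submodule.finrank_add_finrank_orthogonal W
    omega

end Skew

/-! ### Symmetric operators and their exponentials -/

section Diagonalization

variable {E : Type*} [NormedAddCommGroup E] [InnerProductSpace ℝ E]

theorem OrthonormalBasis.inner_apply_self_of_eigen {ι : Type*} [Fintype ι]
    (e : OrthonormalBasis ι ℝ E)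
    {T : E →ₗ[ℝ] E} {l : ι → ℝ} (h : ∀ i, T (e i) = l i • e i) (x y : E) :
    ⟪T x, y⟫_ℝ = ∑ i, l i * (⟪e i, x⟫_ℝ * ⟪e i, y⟫_ℝ) := by
  conv_lhs => rw [← e.sum_repr' x]
  rw [map_sum, sum_inner]
  refine Finset.sum_congr rfl fun i _ => ?_
  rw [map_smul, h, inner_smul_left, inner_smul_left]
  simp only [conj_trivial]
  ring

theorem OrthonormalBasis.isSymmetric_of_eigen {ι : Type*} [Fintype ι] (e : OrthonormalBasis ι ℝ E)
    {T : E →ₗ[ℝ] E} {l : ι → ℝ} (h : ∀ i, T (e i) = l i • e i) : T.IsSymmetric := by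
  intro x y
  rw [e.inner_apply_self_of_eigen h, real_inner_comm, e.inner_apply_self_of_eigen h]
  exact Finset.sum_congr rfl fun i _ => by ring

theorem OrthonormalBasis.pos_of_eigen {ι : Type*} [Fintype ι] (e : OrthonormalBasis ι ℝ E)
    {T : E →ₗ[ℝ] E} {l : ι → ℝ} (h : ∀ i, T (e i) = l i • e i) (hl : ∀ i, 0 < l i) {x : E}
    (hx : x ≠ 0) : 0 < ⟪T x, x⟫_ℝ := by
  rw [e.inner_apply_self_of_eigen h]
  have hnn : ∀ i ∈ Finset.univ, 0 ≤ l i * (⟪e i, x⟫_ℝ * ⟪e i, x⟫_ℝ) :=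
    fun i _ => mul_nonneg (hl i).le (mul_self_nonneg _)
  refine lt_of_le_of_ne (Finset.sum_nonneg hnn) fun h0 => hx ?_
  rw [eq_comm, Finset.sum_eq_zero_iff_of_nonneg hnn] at h0
  rw [← e.sum_repr' x]
  refine Finset.sum_eq_zero fun i hi => ?_
  have h1 := (mul_eq_zero.1 (h0 i hi)).resolve_left (hl i).ne'
  rw [mul_self_eq_zero.1 h1, zero_smul]

variable [FiniteDimensional ℝ E]

theorem LinearMap.IsSymmetric.exists_orthonormalBasis_eigen {T : E →ₗ[ℝ] E} (hT : T.IsSymmetric) :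
    ∃ (e : OrthonormalBasis (Fin (finrank ℝ E)) ℝ E) (l : Fin (finrank ℝ E) → ℝ),
      ∀ i, T (e i) = l i • e i :=
  ⟨hT.eigenvectorBasis rfl, hT.eigenvalues rfl, hT.apply_eigenvectorBasis rfl⟩

/-- The exponential of an endomorphism of a finite-dimensional space. -/
noncomputable def opExp (T : E →ₗ[ℝ] E) : E →ₗ[ℝ] E :=
  (NormedSpace.exp (LinearMap.toContinuousLinearMap T) : E →L[ℝ] E)

theorem opExp_apply_of_eigenvector {T : E →ₗ[ℝ] E} {v : E} {a : ℝ} (h : T v = a • v) :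
    opExp T v = Real.exp a • v := by
  have h1 := NormedSpace.exp_series_hasSum_exp' (𝕂 := ℝ) (LinearMap.toContinuousLinearMap T)
  have h2 := h1.mapL (ContinuousLinearMap.apply ℝ E v)
  have h3 : ∀ n : ℕ, ((LinearMap.toContinuousLinearMap T) ^ n) v = a ^ n • v := by
    intro n
    induction n with
    | zero => simp
    | succ n ih =>
      rw [pow_succ', mul_apply_eq_comp, ih, map_smul,
        LinearMap.coe_toContinuousLinearMap', h, smul_smul, pow_succ]
  have h4 : HasSum (fun n : ℕ => ((n.factorial : ℝ)⁻¹ * a ^ n) • v) (Real.exp a • v) := by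
    have := NormedSpace.exp_series_hasSum_exp' (𝕂 := ℝ) a
    rw [← Real.exp_eq_exp_ℝ] at this
    exact this.smul_const v
  refine HasSum.unique ?_ h4
  convert! h2 using 2 with n
  simp only [ContinuousLinearMap.apply_apply, smul_apply]
  rw [h3, smul_smul]

theorem LinearMap.IsSymmetric.opExp {T : E →ₗ[ℝ] E} (hT : T.IsSymmetric) :
    (opExp T).IsSymmetric := by
  obtain ⟨e, l, h⟩ := hT.exists_orthonormalBasis_eigen
  exact e.isSymmetric_of_eigen fun i => opExp_apply_of_eigenvector (h i)

theorem LinearMap.IsSymmetric.opExp_pos {T : E →ₗ[ℝ] E} (hT : T.IsSymmetric) {x : E}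
    (hx : x ≠ 0) : 0 < ⟪_root_.opExp T x, x⟫_ℝ := by
  obtain ⟨e, l, h⟩ := hT.exists_orthonormalBasis_eigen
  exact e.pos_of_eigen (fun i => opExp_apply_of_eigenvector (h i)) (fun i => Real.exp_pos _) hx

theorem LinearMap.IsSymmetric.opExp_half_opExp_half {T : E →ₗ[ℝ] E} (hT : T.IsSymmetric) (x : E) :
    _root_.opExp ((1 / 2 : ℝ) • T) (_root_.opExp ((1 / 2 : ℝ) • T) x) = _root_.opExp T x := by
  obtain ⟨e, l, h⟩ := hT.exists_orthonormalBasis_eigen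
  have h2 : ∀ i, ((1 / 2 : ℝ) • T) (e i) = (1 / 2 * l i) • e i := by
    intro i
    rw [LinearMap.smul_apply, h, smul_smul]
  have : _root_.opExp ((1 / 2 : ℝ) • T) ∘ₗ _root_.opExp ((1 / 2 : ℝ) • T) = _root_.opExp T := by
    refine e.toBasis.ext fun i => ?_
    rw [OrthonormalBasis.coe_toBasis, LinearMap.comp_apply, opExp_apply_of_eigenvector (h2 i),
      map_smul, opExp_apply_of_eigenvector (h2 i), opExp_apply_of_eigenvector (h i), smul_smul,
      ← Real.exp_add]
    congr 2
    ring
  exact LinearMap.congr_fun this x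

theorem opExp_zero : opExp (0 : E →ₗ[ℝ] E) = LinearMap.id := by
  ext x
  rw [opExp_apply_of_eigenvector (a := 0) (by simp)]
  simp

theorem continuous_inner_opExp {F : Type*} [TopologicalSpace F] {f : F → E →ₗ[ℝ] E}
    (hf : Continuous fun x => LinearMap.toContinuousLinearMap (f x)) (v w : E) :
    Continuous fun x => ⟪opExp (f x) v, w⟫_ℝ := by
  have h1 : Continuous fun x => NormedSpace.exp (LinearMap.toContinuousLinearMap (f x)) :=
    (continuous_iff_continuousAt.2 fun T : E →L[ℝ] E =>
      (NormedSpace.exp_analytic (𝕂 := ℝ) T).continuousAt).comp hf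
  exact (h1.clm_apply continuous_const).inner continuous_const

theorem hasDerivAt_inner_opExp_smul (T : E →ₗ[ℝ] E) (v w : E) :
    HasDerivAt (fun t : ℝ => ⟪opExp (t • T) v, w⟫_ℝ) ⟪T v, w⟫_ℝ 0 := by
  have h1 := hasDerivAt_exp_smul_const (𝕂 := ℝ) (LinearMap.toContinuousLinearMap T) (0 : ℝ)
  rw [zero_smul, NormedSpace.exp_zero, one_mul] at h1
  have h2 := (h1.clm_apply (hasDerivAt_const (0 : ℝ) v)).inner ℝ (hasDerivAt_const (0 : ℝ) w)
  have h3 : (fun t : ℝ => ⟪opExp (t • T) v, w⟫_ℝ) = fun t : ℝ =>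
      ⟪NormedSpace.exp (t • LinearMap.toContinuousLinearMap T) v, w⟫_ℝ := by
    funext t
    rw [opExp, map_smul]
    rfl
  rw [h3]
  convert! h2 using 1
  simp

/-- If the quadratic forms of `exp (t T)` stay bounded on `v` for `t ≥ 0`, then `v` is orthogonal to
the eigenvectors of `T` with positive eigenvalue. -/
theorem LinearMap.IsSymmetric.inner_eq_zero_of_opExp_bounded {T : E →ₗ[ℝ] E} (hT : T.IsSymmetric)
    {v : E} {B : ℝ} (hB : ∀ t : ℝ, 0 ≤ t → ⟪_root_.opExp (t • T) v, v⟫_ℝ ≤ B) {a : ℝ} (ha : 0 < a)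
    {w : E} (hw : T w = a • w) : ⟪w, v⟫_ℝ = 0 := by
  obtain ⟨e, l, h⟩ := hT.exists_orthonormalBasis_eigen
  have key : ∀ i, l i = a → ⟪e i, v⟫_ℝ = 0 := by
    intro i hi
    by_contra hne
    have hpos : 0 < ⟪e i, v⟫_ℝ * ⟪e i, v⟫_ℝ := mul_self_pos.2 hne
    -- The bound `1 + x ≤ exp x` makes the coefficient along `e i` grow at least linearly in `t`.
    have hBt : ∀ t : ℝ, 0 ≤ t → (t * a) * (⟪e i, v⟫_ℝ * ⟪e i, v⟫_ℝ) ≤ B := by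
      intro t ht
      refine le_trans ?_ (hB t ht)
      have h2 : ∀ j, (t • T) (e j) = (t * l j) • e j := by
        intro j
        rw [LinearMap.smul_apply, h, smul_smul]
      rw [e.inner_apply_self_of_eigen fun j => opExp_apply_of_eigenvector (h2 j)]
      refine le_trans ?_ (Finset.single_le_sum
        (f := fun j => Real.exp (t * l j) * (⟪e j, v⟫_ℝ * ⟪e j, v⟫_ℝ))
        (fun j _ => mul_nonneg (Real.exp_pos _).le (mul_self_nonneg _)) (Finset.mem_univ i))
      refine mul_le_mul_of_nonneg_right ?_ hpos.le
      rw [hi]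
      linarith [Real.add_one_le_exp (t * a)]
    have hc : 0 < a * (⟪e i, v⟫_ℝ * ⟪e i, v⟫_ℝ) := mul_pos ha hpos
    -- This time makes the linear lower bound equal to `|B| + 1`, which exceeds `B`.
    have := hBt ((|B| + 1) / (a * (⟪e i, v⟫_ℝ * ⟪e i, v⟫_ℝ))) (by positivity)
    rw [mul_assoc, div_mul_cancel₀ _ hc.ne'] at this
    linarith [le_abs_self B]
  rw [← e.sum_inner_mul_inner w v]
  refine Finset.sum_eq_zero fun i _ => ?_
  by_cases hi : l i = a
  · rw [key i hi, mul_zero]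
  · have h1 := hT (e i) w
    rw [h, hw, inner_smul_left, inner_smul_right, conj_trivial] at h1
    have h2 : (l i - a) * ⟪e i, w⟫_ℝ = 0 := by rw [sub_mul, h1, sub_self]
    rw [real_inner_comm, (mul_eq_zero.1 h2).resolve_left (sub_ne_zero.2 hi), zero_mul]

/-- On each eigenvector, `exp (s l) ≤ 1 + exp (t l)` whatever the sign of `l`. This carries an
energy bound at the end of a ray back to all its earlier points. -/
theorem LinearMap.IsSymmetric.inner_opExp_smul_le {T : E →ₗ[ℝ] E} (hT : T.IsSymmetric) (v : E)
    {s t : ℝ} (hs : 0 ≤ s) (hst : s ≤ t) :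
    ⟪_root_.opExp (s • T) v, v⟫_ℝ ≤ ⟪v, v⟫_ℝ + ⟪_root_.opExp (t • T) v, v⟫_ℝ := by
  obtain ⟨e, l, h⟩ := hT.exists_orthonormalBasis_eigen
  have h2 : ∀ (r : ℝ) j, (r • T) (e j) = (r * l j) • e j := by
    intro r j
    rw [LinearMap.smul_apply, h, smul_smul]
  rw [e.inner_apply_self_of_eigen fun j => opExp_apply_of_eigenvector (h2 s j),
    e.inner_apply_self_of_eigen fun j => opExp_apply_of_eigenvector (h2 t j),
    ← e.sum_inner_mul_inner v v, ← Finset.sum_add_distrib]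
  refine Finset.sum_le_sum fun i _ => ?_
  rw [real_inner_comm (e i) v, ← one_add_mul]
  refine mul_le_mul_of_nonneg_right ?_ (mul_self_nonneg _)
  rcases le_total 0 (l i) with hl | hl
  · have := Real.exp_le_exp.2 (mul_le_mul_of_nonneg_right hst hl)
    linarith
  · have h3 : Real.exp (s * l i) ≤ 1 := Real.exp_le_one_iff.2 (mul_nonpos_of_nonneg_of_nonpos hs hl)
    have := Real.exp_pos (t * l i)
    linarith

end Diagonalization

/-! ### Lie algebras with a Cartan involution -/

/-- The data of a semisimple real Lie algebra of real rank one with a Cartan involution `θ`, on an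
inner product space `E` whose inner product is `(x, y) ↦ -κ(x, θ y)`. -/
structure CartanBracket {E : Type*} [NormedAddCommGroup E] [InnerProductSpace ℝ E]
    (br : E →ₗ[ℝ] E →ₗ[ℝ] E) (θ : E →ₗ[ℝ] E) : Prop where
  br_self : ∀ x, br x x = 0
  jacobi : ∀ x y z, br x (br y z) = br (br x y) z + br y (br x z)
  theta_theta : ∀ x, θ (θ x) = x
  theta_br : ∀ x y, θ (br x y) = br (θ x) (θ y)
  inner_br : ∀ x y z, ⟪br x y, z⟫_ℝ = -⟪y, br (θ x) z⟫_ℝ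
  inner_derivation : ∀ D : E →ₗ[ℝ] E, (∀ x y, D (br x y) = br (D x) y + br x (D y)) →
    ∃ x, br x = D
  center : ∀ x, br x = 0 → x = 0
  faithful : ∀ k, θ k = k → (∀ p, θ p = -p → br k p = 0) → k = 0
  rank_one : ∀ x y, θ x = -x → θ y = -y → br x y = 0 → x ≠ 0 → ∃ c : ℝ, y = c • x

namespace CartanBracket

variable {E : Type*} [NormedAddCommGroup E] [InnerProductSpace ℝ E]
  {br : E →ₗ[ℝ] E →ₗ[ℝ] E} {θ : E →ₗ[ℝ] E}

/-- The `(-1)`-eigenspace of the Cartan involution. -/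
abbrev pSpace (θ : E →ₗ[ℝ] E) : Submodule ℝ E := LinearMap.ker (θ + LinearMap.id)

theorem mem_pSpace {x : E} : x ∈ pSpace θ ↔ θ x = -x := by
  rw [LinearMap.mem_ker, LinearMap.add_apply, LinearMap.id_apply, add_eq_zero_iff_eq_neg]

theorem br_swap (H : CartanBracket br θ) (x y : E) : br x y = -br y x := by
  have := H.br_self (x + y)
  rw [map_add, LinearMap.map_add₂, LinearMap.map_add₂, H.br_self, H.br_self, zero_add,
    add_zero] at this
  exact eq_neg_of_add_eq_zero_right this

/-- The adjoint of `ad x` is `-ad (θ x)`, so 𝔭 acts by symmetric operators and 𝔨 by skew ones. -/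
theorem isSymmetric_br (H : CartanBracket br θ) {q : E} (hq : θ q = -q) : (br q).IsSymmetric := by
  intro x y
  rw [H.inner_br, hq, map_neg, LinearMap.neg_apply, inner_neg_right, neg_neg]

theorem inner_br_of_fixed (H : CartanBracket br θ) {k : E} (hk : θ k = k) (x y : E) :
    ⟪br k x, y⟫_ℝ = -⟪x, br k y⟫_ℝ := by
  rw [H.inner_br, hk]

theorem br_add_eigen (H : CartanBracket br θ) {q x y : E} {a b : ℝ} (hx : br q x = a • x)
    (hy : br q y = b • y) : br q (br x y) = (a + b) • br x y := by
  rw [H.jacobi, hx, hy, map_smul, LinearMap.smul_apply, map_smul, add_smul]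

theorem theta_smul_of_neg {p : E} (hp : θ p = -p) (t : ℝ) : θ (t • p) = -(t • p) := by
  rw [map_smul, hp, smul_neg]

/-- If the moment map vanishes on a commuting family, then the family commutes with its
`θ`-conjugate. -/
theorem br_theta_eq_zero_of_balanced (H : CartanBracket br θ) {ι : Type*} [Fintype ι] (b : ι → E)
    (hab : ∀ i j, br (b i) (b j) = 0) (hbal : ∑ i, br (b i) (θ (b i)) = 0) (i j : ι) :
    br (θ (b i)) (b j) = 0 := by
  -- Moving `ad (θ b_i)` across the inner product turns it into `-ad b_i`; Jacobi and commutativity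
  -- leave only the bracket `[b_i, θ b_i]`, whose sum over `i` is zero.
  have h1 : ∀ i, ⟪br (θ (b i)) (b j), br (θ (b i)) (b j)⟫_ℝ =
      -⟪br (br (b i) (θ (b i))) (b j), b j⟫_ℝ := by
    intro i
    rw [H.inner_br, H.theta_theta, H.jacobi (b i), hab, map_zero, add_zero, real_inner_comm]
  have h2 : ∑ i, ⟪br (θ (b i)) (b j), br (θ (b i)) (b j)⟫_ℝ = 0 := by
    rw [Finset.sum_congr rfl fun i _ => h1 i, Finset.sum_neg_distrib, ← sum_inner,
      ← LinearMap.sum_apply, ← map_sum, hbal]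
    simp
  rw [Finset.sum_eq_zero_iff_of_nonneg fun i _ => real_inner_self_nonneg] at h2
  exact inner_self_eq_zero.1 (h2 i (Finset.mem_univ i))

variable [FiniteDimensional ℝ E]

/-- Eigenvalues of `ad q` add under the bracket, so their exponentials multiply; it suffices to test
on an eigenbasis. -/
theorem opExp_br (H : CartanBracket br θ) {q : E} (hq : θ q = -q) (x y : E) :
    opExp (br q) (br x y) = br (opExp (br q) x) (opExp (br q) y) := by
  obtain ⟨e, l, h⟩ := (H.isSymmetric_br hq).exists_orthonormalBasis_eigen
  have h1 : br.compr₂ (opExp (br q)) = br.compl₁₂ (opExp (br q)) (opExp (br q)) := by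
    refine e.toBasis.ext fun i => e.toBasis.ext fun j => ?_
    rw [OrthonormalBasis.coe_toBasis, LinearMap.compr₂_apply, LinearMap.compl₁₂_apply,
      opExp_apply_of_eigenvector (h i), opExp_apply_of_eigenvector (h j),
      opExp_apply_of_eigenvector (H.br_add_eigen (h i) (h j)), map_smul,
      LinearMap.map_smul₂, smul_smul, Real.exp_add, mul_comm]
  exact LinearMap.congr_fun₂ h1 x y

/-- A positive definite automorphism is the exponential of `ad p` with `θ p = -p`. -/
theorem exists_eq_opExp (H : CartanBracket br θ) {S : E →ₗ[ℝ] E} (hS : S.IsSymmetric)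
    (hpos : ∀ x, x ≠ 0 → 0 < ⟪S x, x⟫_ℝ) (hbr : ∀ x y, S (br x y) = br (S x) (S y)) :
    ∃ p, θ p = -p ∧ S = opExp (br p) := by
  obtain ⟨e, l, h⟩ := hS.exists_orthonormalBasis_eigen
  have hl : ∀ i, 0 < l i := by
    intro i
    have := hpos (e i) (e.orthonormal.ne_zero i)
    rw [h, inner_smul_left, real_inner_self_eq_norm_sq, e.orthonormal.1 i] at this
    simpa using this
  -- `D` is the logarithm of `S`. Eigenvalues of `S` multiply under the bracket, so those of `D` add
  -- and `D` is a derivation, hence inner.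
  set D : E →ₗ[ℝ] E := e.toBasis.constr ℝ fun i => Real.log (l i) • e i with hD
  have hDe : ∀ i, D (e i) = Real.log (l i) • e i := by
    intro i
    have := e.toBasis.constr_basis ℝ (fun i => Real.log (l i) • e i) i
    rwa [OrthonormalBasis.coe_toBasis] at this
  -- Needed beyond the basis: the bracket of two basis vectors is an eigenvector of `S` but need not
  -- be a basis vector.
  have hDw : ∀ (w : E) (a : ℝ), S w = a • w → D w = Real.log a • w := by
    intro w a hw
    conv_lhs => rw [← e.sum_repr' w]
    conv_rhs => rw [← e.sum_repr' w]
    rw [map_sum, Finset.smul_sum]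
    refine Finset.sum_congr rfl fun i _ => ?_
    rw [map_smul, hDe]
    by_cases hi : l i = a
    · rw [hi, smul_comm]
    · have h1 := hS (e i) w
      rw [h, hw, inner_smul_left, inner_smul_right, conj_trivial] at h1
      have h2 : (l i - a) * ⟪e i, w⟫_ℝ = 0 := by rw [sub_mul, h1, sub_self]
      rw [(mul_eq_zero.1 h2).resolve_left (sub_ne_zero.2 hi)]
      simp
  have hder : ∀ x y, D (br x y) = br (D x) y + br x (D y) := by
    have h1 : br.compr₂ D = br.compl₁₂ D LinearMap.id + br.compl₁₂ LinearMap.id D := by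
      refine e.toBasis.ext fun i => e.toBasis.ext fun j => ?_
      have h2 : S (br (e i) (e j)) = (l i * l j) • br (e i) (e j) := by
        rw [hbr, h, h, map_smul, LinearMap.map_smul₂, smul_smul, mul_comm]
      rw [OrthonormalBasis.coe_toBasis, LinearMap.add_apply, LinearMap.add_apply,
        LinearMap.compr₂_apply, LinearMap.compl₁₂_apply, LinearMap.compl₁₂_apply, hDw _ _ h2,
        LinearMap.id_apply, LinearMap.id_apply, hDe, hDe, map_smul, LinearMap.smul_apply, map_smul,
        Real.log_mul (hl i).ne' (hl j).ne', add_smul]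
    exact LinearMap.congr_fun₂ h1
  obtain ⟨p, hp⟩ := H.inner_derivation D hder
  have hDsym := e.isSymmetric_of_eigen hDe
  refine ⟨p, ?_, ?_⟩
  · have h0 : θ p + p = 0 := by
      apply H.center
      ext z
      apply ext_inner_left ℝ
      intro y
      have h1 := H.inner_br p y z
      rw [hp, hDsym y z, ← hp] at h1
      rw [map_add, LinearMap.add_apply, inner_add_right, h1]
      simp
    exact eq_neg_of_add_eq_zero_left h0
  · refine e.toBasis.ext fun i => ?_
    rw [OrthonormalBasis.coe_toBasis, h, hp, opExp_apply_of_eigenvector (hDe i),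
      Real.exp_log (hl i)]

theorem continuous_toContinuousLinearMap_br :
    Continuous fun x => LinearMap.toContinuousLinearMap (br x) :=
  ((LinearMap.toContinuousLinearMap (𝕜 := ℝ) (E := E) (F' := E)).toLinearMap ∘ₗ
    br).continuous_of_finiteDimensional

/-! ### The energy on 𝔭 and the moment map -/

/-- The function minimised in the search for a conjugate of a subalgebra adapted to `θ`. -/
noncomputable def energy (br : E →ₗ[ℝ] E →ₗ[ℝ] E) {ι : Type*} [Fintype ι] (b : ι → E) (p : E) :
    ℝ :=
  ∑ i, ⟪opExp (br p) (b i), b i⟫_ℝ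

theorem continuous_energy {ι : Type*} [Fintype ι] (b : ι → E) : Continuous (energy br b) :=
  continuous_finsetSum _ fun i _ =>
    continuous_inner_opExp continuous_toContinuousLinearMap_br (b i) (b i)

theorem inner_opExp_le_energy (H : CartanBracket br θ) {ι : Type*} [Fintype ι] (b : ι → E) {p : E}
    (hp : θ p = -p) (i : ι) : ⟪opExp (br p) (b i), b i⟫_ℝ ≤ energy br b p := by
  refine Finset.single_le_sum (f := fun i => ⟪opExp (br p) (b i), b i⟫_ℝ) (fun j _ => ?_)
    (Finset.mem_univ i)
  by_cases hj : b j = 0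
  · simp [hj]
  · exact ((H.isSymmetric_br hp).opExp_pos hj).le

/-- Either the energy attains its minimum on `𝔭`, or the vectors lie in a common parabolic. -/
theorem exists_min_or_parabolic (H : CartanBracket br θ) {ι : Type*} [Fintype ι] (b : ι → E) :
    (∃ p₀, θ p₀ = -p₀ ∧ ∀ p, θ p = -p → energy br b p₀ ≤ energy br b p) ∨
    ∃ q, θ q = -q ∧ q ≠ 0 ∧ ∀ a : ℝ, a < 0 → ∀ w, br q w = a • w → ∀ i, ⟪w, b i⟫_ℝ = 0 := by
  by_cases hcoer : ∃ R : ℝ, ∀ p, θ p = -p → energy br b p ≤ energy br b 0 → ‖p‖ ≤ R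
  · left
    obtain ⟨R, hR⟩ := hcoer
    have hcl : IsClosed {p : E | θ p = -p} :=
      isClosed_eq θ.continuous_of_finiteDimensional continuous_neg
    have hK : IsCompact ({p : E | θ p = -p} ∩ Metric.closedBall 0 R) := by
      rw [Set.inter_comm]
      exact (isCompact_closedBall _ _).inter_right hcl
    have h0 : θ (0 : E) = -0 := by simp
    have h0mem : (0 : E) ∈ {p : E | θ p = -p} ∩ Metric.closedBall 0 R :=
      ⟨h0, by rw [mem_closedBall_zero_iff]; exact hR 0 h0 le_rfl⟩
    obtain ⟨p₀, hp₀, hmin⟩ := hK.exists_isMinOn ⟨0, h0mem⟩ (continuous_energy b).continuousOn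
    refine ⟨p₀, hp₀.1, fun p hp => ?_⟩
    rcases le_total (energy br b p) (energy br b 0) with hle | hle
    · exact hmin ⟨hp, by rw [mem_closedBall_zero_iff]; exact hR p hp hle⟩
    · exact (hmin h0mem).trans hle
  · right
    push Not at hcoer
    -- Points of the sublevel set escaping to infinity; their normalized directions subconverge to
    -- some `v` on the unit sphere.
    choose p hp hpe hpn using fun n : ℕ => hcoer n
    have hn0 : ∀ n, ‖p n‖ ≠ 0 := fun n => ((Nat.cast_nonneg n).trans_lt (hpn n)).ne'
    let u : ℕ → E := fun n => ‖p n‖⁻¹ • p n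
    have hu : ∀ n, u n ∈ Metric.sphere (0 : E) 1 := by
      intro n
      rw [mem_sphere_zero_iff_norm, norm_smul, norm_inv, norm_norm, inv_mul_cancel₀ (hn0 n)]
    obtain ⟨v, hv, φ, hφ, hlim⟩ := (isCompact_sphere (0 : E) 1).tendsto_subseq hu
    have hup : ∀ n, θ (u n) = -u n := fun n => theta_smul_of_neg (hp n) _
    have hvp : θ v = -v :=
      (isClosed_eq θ.continuous_of_finiteDimensional continuous_neg).mem_of_tendsto hlim
        (Filter.Eventually.of_forall fun n => hup (φ n))
    have hv0 : v ≠ 0 := by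
      rintro rfl
      simp at hv
    have hbound : ∀ i, ∀ t : ℝ, 0 ≤ t →
        ⟪opExp (t • br v) (b i), b i⟫_ℝ ≤ ⟪b i, b i⟫_ℝ + energy br b 0 := by
      intro i t ht
      have hc : Continuous fun x : E => ⟪opExp (br (t • x)) (b i), b i⟫_ℝ :=
        (continuous_inner_opExp continuous_toContinuousLinearMap_br (b i) (b i)).comp
          (continuous_const_smul t)
      rw [← map_smul]
      refine le_of_tendsto ((hc.tendsto v).comp hlim) ?_
      obtain ⟨N, hN⟩ := exists_nat_ge t
      filter_upwards [Filter.eventually_ge_atTop N] with n hn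
      have h1 : t ≤ ‖p (φ n)‖ := by
        have h2 : (N : ℝ) ≤ φ n := by exact_mod_cast hn.trans (hφ.id_le n)
        linarith [hpn (φ n)]
      have h3 := (H.isSymmetric_br (hup (φ n))).inner_opExp_smul_le (b i) ht h1
      have h4 : ‖p (φ n)‖ • br (u (φ n)) = br (p (φ n)) := by
        rw [← map_smul, smul_smul, mul_inv_cancel₀ (hn0 _), one_smul]
      rw [h4] at h3
      simp only [Function.comp_apply, map_smul]
      linarith [H.inner_opExp_le_energy b (hp (φ n)) i, hpe (φ n)]
    -- The bounded energy kills components on positive eigenspaces of `ad v`; the sign change makes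
    -- these the negative ones of `ad q`.
    refine ⟨-v, by rw [map_neg, hvp], neg_ne_zero.2 hv0, fun a ha w hw i => ?_⟩
    refine (H.isSymmetric_br hvp).inner_eq_zero_of_opExp_bounded (hbound i) (neg_pos.2 ha) ?_
    rw [neg_smul, ← hw, map_neg, LinearMap.neg_apply, neg_neg]

/-- At a minimum of the energy, conjugating by `exp (ad p₀ / 2)` makes the moment map vanish. -/
theorem exists_balanced_of_min (H : CartanBracket br θ) {ι : Type*} [Fintype ι] (b : ι → E) {p₀ : E}
    (hp₀ : θ p₀ = -p₀) (hmin : ∀ p, θ p = -p → energy br b p₀ ≤ energy br b p) :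
    ∃ R : E →ₗ[ℝ] E, Function.Injective R ∧ (∀ x y, R (br x y) = br (R x) (R y)) ∧
      ∑ i, br (R (b i)) (θ (R (b i))) = 0 := by
  set R : E →ₗ[ℝ] E := opExp (br ((1 / 2 : ℝ) • p₀)) with hR
  have hhalf := theta_smul_of_neg hp₀ (1 / 2 : ℝ)
  have hRsym : R.IsSymmetric := (H.isSymmetric_br hhalf).opExp
  have hRbr := H.opExp_br hhalf
  have hRR : ∀ x, R (R x) = opExp (br p₀) x := by
    intro x
    rw [hR, map_smul]
    exact (H.isSymmetric_br hp₀).opExp_half_opExp_half x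
  have hinj : Function.Injective R := by
    rw [injective_iff_map_eq_zero]
    intro x hx
    by_contra hne
    have := (H.isSymmetric_br hhalf).opExp_pos hne
    rw [← hR, hx, inner_zero_left] at this
    exact lt_irrefl _ this
  refine ⟨R, hinj, hRbr, ?_⟩
  have hcrit : ∀ q, θ q = -q → ∑ i, ⟪br q (R (b i)), R (b i)⟫_ℝ = 0 := by
    intro q hq
    have hder : HasDerivAt (fun t : ℝ => ∑ i, ⟪opExp (t • br q) (R (b i)), R (b i)⟫_ℝ)
        (∑ i, ⟪br q (R (b i)), R (b i)⟫_ℝ) 0 :=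
      HasDerivAt.fun_sum fun i _ => hasDerivAt_inner_opExp_smul (br q) (R (b i)) (R (b i))
    refine IsLocalMin.hasDerivAt_eq_zero (Filter.Eventually.of_forall fun t => ?_) hder
    have htq := theta_smul_of_neg hq t
    -- `R exp(t ad q) R` is again a positive definite automorphism, hence `exp (ad p)` for some `p ∈
    -- 𝔭`. So the curve being differentiated consists of energy values and is minimal at `t = 0`.
    obtain ⟨p, hp, hpS⟩ := H.exists_eq_opExp (S := R ∘ₗ opExp (t • br q) ∘ₗ R)
      (by
        intro x y
        simp only [LinearMap.comp_apply]
        rw [hRsym, ← map_smul, (H.isSymmetric_br htq).opExp, hRsym])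
      (by
        intro x hx
        simp only [LinearMap.comp_apply]
        rw [hRsym, ← map_smul]
        exact (H.isSymmetric_br htq).opExp_pos fun h => hx (hinj (by rw [h, map_zero])))
      (by
        intro x y
        simp only [LinearMap.comp_apply]
        rw [hRbr, ← map_smul, H.opExp_br htq, hRbr])
    have h1 := hmin p hp
    have h2 : energy br b p = ∑ i, ⟪opExp (t • br q) (R (b i)), R (b i)⟫_ℝ := by
      rw [energy, ← hpS]
      exact Finset.sum_congr rfl fun i _ => hRsym _ _
    have h3 : energy br b p₀ = ∑ i, ⟪opExp ((0 : ℝ) • br q) (R (b i)), R (b i)⟫_ℝ := by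
      rw [energy, zero_smul, opExp_zero]
      refine Finset.sum_congr rfl fun i _ => ?_
      rw [← hRR, hRsym]
      rfl
    rw [← h2, ← h3]
    exact h1
  set s := ∑ i, br (R (b i)) (θ (R (b i))) with hs
  have hsp : θ s = -s := by
    rw [hs, map_sum, ← Finset.sum_neg_distrib]
    refine Finset.sum_congr rfl fun i _ => ?_
    rw [H.theta_br, H.theta_theta, H.br_swap]
  -- Testing criticality in the direction of the moment map `s` itself gives `-⟪s, s⟫ = 0`.
  have h1 := hcrit s hsp
  have h2 : ∀ x, ⟪br s x, x⟫_ℝ = -⟪s, br x (θ x)⟫_ℝ := by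
    intro x
    rw [H.br_swap s x, inner_neg_left, H.inner_br, neg_neg, H.br_swap (θ x) x, inner_neg_right]
  rw [Finset.sum_congr rfl fun i _ => h2 (R (b i)), Finset.sum_neg_distrib, ← inner_sum, ← hs,
    neg_eq_zero] at h1
  exact inner_self_eq_zero.1 h1

end CartanBracket

/-! ### The eigenvalue filtration of ad q and its parabolic -/

namespace CartanBracket

variable {E : Type*} [NormedAddCommGroup E] [InnerProductSpace ℝ E]
  {br : E →ₗ[ℝ] E →ₗ[ℝ] E} {θ : E →ₗ[ℝ] E}

/-- The sum of the eigenspaces of `ad q` with eigenvalue greater than `a`. -/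
def upper (br : E →ₗ[ℝ] E →ₗ[ℝ] E) (q : E) (a : ℝ) : Submodule ℝ E :=
  ⨆ (b : ℝ) (_ : a < b), End.eigenspace (br q) b

theorem mem_upper_of_eigen {q w : E} {a b : ℝ} (hab : a < b) (hw : br q w = b • w) :
    w ∈ upper br q a :=
  Submodule.mem_iSup_of_mem b (Submodule.mem_iSup_of_mem hab (End.mem_eigenspace_iff.2 hw))

theorem upper_le {q : E} {a : ℝ} {P : Submodule ℝ E}
    (h : ∀ b, a < b → ∀ w, br q w = b • w → w ∈ P) : upper br q a ≤ P :=
  iSup₂_le fun b hb _ hw => h b hb _ (End.mem_eigenspace_iff.1 hw)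

theorem upper_antitone {q : E} {a b : ℝ} (hab : a ≤ b) : upper br q b ≤ upper br q a :=
  upper_le fun _ hc _ hw => mem_upper_of_eigen (hab.trans_lt hc) hw

theorem br_eigen_upper (H : CartanBracket br θ) {q z x : E} {a b : ℝ} (hz : br q z = a • z)
    (hx : x ∈ upper br q b) : br z x ∈ upper br q (a + b) := by
  have : upper br q b ≤ (upper br q (a + b)).comap (br z) :=
    upper_le fun c hc w hw =>
      mem_upper_of_eigen (by linarith : a + b < a + c) (H.br_add_eigen hz hw)
  exact this hx

theorem br_centralizer_upper (H : CartanBracket br θ) {q z x : E} {b : ℝ} (hz : br q z = 0)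
    (hx : x ∈ upper br q b) : br z x ∈ upper br q b := by
  have := H.br_eigen_upper (a := 0) (by rw [hz, zero_smul]) hx
  rwa [zero_add] at this

theorem br_upper_upper (H : CartanBracket br θ) {q x y : E} {a b : ℝ} (hx : x ∈ upper br q a)
    (hy : y ∈ upper br q b) : br x y ∈ upper br q (a + b) := by
  have : upper br q a ≤ (upper br q (a + b)).comap (br.flip y) :=
    upper_le fun c hc w hw =>
      upper_antitone (by linarith : a + b ≤ c + b) (H.br_eigen_upper hw hy)
  exact this hx

/-- Eigenspaces of a symmetric operator are orthogonal. A vector lying both in the `a`-eigenspace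
and in `upper br q a` is thus orthogonal to itself, which is how components are separated below. -/
theorem inner_eigen_upper (H : CartanBracket br θ) {q w x : E} (hq : θ q = -q) {a b : ℝ}
    (hab : a ≤ b) (hw : br q w = a • w) (hx : x ∈ upper br q b) : ⟪w, x⟫_ℝ = 0 := by
  have : upper br q b ≤ LinearMap.ker (innerₛₗ ℝ w) :=
    upper_le fun c hc v hv => by
      have h1 := H.isSymmetric_br hq w v
      rw [hw, hv, inner_smul_left, inner_smul_right, conj_trivial] at h1
      have h2 : (a - c) * ⟪w, v⟫_ℝ = 0 := by rw [sub_mul, h1, sub_self]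
      exact (mul_eq_zero.1 h2).resolve_left (by linarith)
  exact this hx

theorem theta_eigen (H : CartanBracket br θ) {q w : E} (hq : θ q = -q) {a : ℝ}
    (hw : br q w = a • w) : br q (θ w) = (-a) • θ w := by
  have h1 := H.theta_br q w
  rw [hw, hq, map_smul, map_neg, LinearMap.neg_apply] at h1
  rw [neg_smul, h1, neg_neg]

theorem inner_theta_upper (H : CartanBracket br θ) {q x y : E} (hq : θ q = -q)
    (hx : x ∈ upper br q 0) (hy : y ∈ upper br q 0) : ⟪θ x, y⟫_ℝ = 0 := by
  have : upper br q 0 ≤ LinearMap.ker ((innerₛₗ ℝ).flip y ∘ₗ θ) :=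
    upper_le fun c hc v hv =>
      H.inner_eigen_upper hq (neg_nonpos.2 hc.le) (H.theta_eigen hq hv) hy
  exact this hx

/-- The centralizer of a nonzero `q ∈ 𝔭` is spanned by `q` and fixed points of `θ`. -/
theorem exists_sub_smul_fixed (H : CartanBracket br θ) {q z : E} (hq : θ q = -q) (hq0 : q ≠ 0)
    (hz : br q z = 0) :
    ∃ c : ℝ, z - θ z = c • q ∧ θ (z - (1 / 2 * c) • q) = z - (1 / 2 * c) • q := by
  have hθz : br q (θ z) = 0 := by
    have := H.theta_eigen hq (w := z) (a := 0) (by rw [hz, zero_smul])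
    rwa [neg_zero, zero_smul] at this
  -- The 𝔭-part of `z` is half of `z - θ z` and still commutes with `q`, so rank one makes it `(c /
  -- 2) q`.
  obtain ⟨c, hc⟩ := H.rank_one q (z - θ z) hq (by rw [map_sub, H.theta_theta, neg_sub])
    (by rw [map_sub, hz, hθz, sub_zero]) hq0
  refine ⟨c, hc, ?_⟩
  have h2 : θ z = z - c • q := by rw [← hc, sub_sub_cancel]
  rw [map_sub, map_smul, hq, h2]
  module

/-- If `c + x` centralizes `u`, with `c` in the Levi factor and `x` in the nilradical, then `c`
centralizes the leading term of `u`. -/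
theorem br_leading_eq_zero (H : CartanBracket br θ) {q c x u v : E} (hq : θ q = -q) {a : ℝ}
    (hc : br q c = 0) (hx : x ∈ upper br q 0) (hu : br q u = a • u)
    (hv : v ∈ upper br q a) (h : br (c + x) (u + v) = 0) : br c u = 0 := by
  have hcu : br q (br c u) = a • br c u := by
    have := H.br_add_eigen (a := 0) (by rw [hc, zero_smul]) hu
    rwa [zero_add] at this
  have h1 : br c v ∈ upper br q a := H.br_centralizer_upper hc hv
  have h2 : br x u ∈ upper br q a := by
    have := H.br_eigen_upper hu hx
    rw [add_zero] at this
    rw [H.br_swap]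
    exact Submodule.neg_mem _ this
  have h3 : br x v ∈ upper br q a := by
    have := H.br_upper_upper hx hv
    rwa [zero_add] at this
  have h4 : br c u = -(br c v + br x u + br x v) := by
    rw [LinearMap.map_add₂, map_add, map_add] at h
    rw [eq_neg_iff_add_eq_zero, ← h]
    abel
  have h5 : br c u ∈ upper br q a := by
    rw [h4]
    exact Submodule.neg_mem _ (Submodule.add_mem _ (Submodule.add_mem _ h1 h2) h3)
  exact inner_self_eq_zero.1 (H.inner_eigen_upper hq le_rfl hcu h5)

variable [FiniteDimensional ℝ E]

/-- A nonzero element of `upper br q a` has a leading term. -/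
theorem exists_leading (H : CartanBracket br θ) {q x : E} (hq : θ q = -q) {a : ℝ}
    (hx : x ∈ upper br q a) (hx0 : x ≠ 0) :
    ∃ b u v, a < b ∧ u ≠ 0 ∧ br q u = b • u ∧ v ∈ upper br q b ∧ x = u + v := by
  obtain ⟨e, l, h⟩ := (H.isSymmetric_br hq).exists_orthonormalBasis_eigen
  obtain ⟨i₀, hi₀⟩ : ∃ i, ⟪e i, x⟫_ℝ ≠ 0 := by
    by_contra! hcon
    apply hx0
    rw [← e.sum_repr' x]
    exact Finset.sum_eq_zero fun i _ => by rw [hcon i, zero_smul]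
  -- The leading term is the component of least eigenvalue among those occurring in `x`.
  obtain ⟨i, hi, hmin⟩ := Finset.exists_min_image (Finset.univ.filter fun i => ⟪e i, x⟫_ℝ ≠ 0) l
    ⟨i₀, by simpa using hi₀⟩
  have hix : ⟪e i, x⟫_ℝ ≠ 0 := by simpa using hi
  refine ⟨l i, ∑ j with l j = l i, ⟪e j, x⟫_ℝ • e j, ∑ j with ¬ l j = l i, ⟪e j, x⟫_ℝ • e j,
    ?_, ?_, ?_, ?_, ?_⟩
  · by_contra! hle
    exact hix (H.inner_eigen_upper hq hle (h i) hx)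
  · intro h0
    apply hix
    have h1 : ⟪e i, ∑ j with l j = l i, ⟪e j, x⟫_ℝ • e j⟫_ℝ = ⟪e i, x⟫_ℝ := by
      rw [inner_sum, Finset.sum_eq_single i]
      · rw [inner_smul_right, real_inner_self_eq_norm_sq, e.orthonormal.1 i]; simp
      · intro j _ hj
        rw [inner_smul_right, e.orthonormal.2 hj.symm, mul_zero]
      · simp
    rw [← h1, h0, inner_zero_right]
  · rw [map_sum, Finset.smul_sum]
    refine Finset.sum_congr rfl fun j hj => ?_
    rw [map_smul, h, (Finset.mem_filter.1 hj).2, smul_comm]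
  · refine Submodule.sum_mem _ fun j hj => ?_
    by_cases hjx : ⟪e j, x⟫_ℝ = 0
    · rw [hjx, zero_smul]; exact Submodule.zero_mem _
    · have h1 := hmin j (by simpa using hjx)
      have h2 : l i < l j := lt_of_le_of_ne h1 fun h => (Finset.mem_filter.1 hj).2 h.symm
      exact Submodule.smul_mem _ _ (mem_upper_of_eigen h2 (h j))
  · rw [Finset.sum_filter_add_sum_filter_not, e.sum_repr' x]

/-- A vector orthogonal to the eigenspaces with negative eigenvalue lies in the parabolic. -/
theorem exists_parabolic_decomposition (H : CartanBracket br θ) {q x : E} (hq : θ q = -q)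
    (hx : ∀ a : ℝ, a < 0 → ∀ w, br q w = a • w → ⟪w, x⟫_ℝ = 0) :
    ∃ z u, br q z = 0 ∧ u ∈ upper br q 0 ∧ x = z + u := by
  obtain ⟨e, l, h⟩ := (H.isSymmetric_br hq).exists_orthonormalBasis_eigen
  have hmem : x ∈ LinearMap.ker (br q) ⊔ upper br q 0 := by
    rw [← e.sum_repr' x]
    refine Submodule.sum_mem _ fun i _ => ?_
    rcases lt_trichotomy (l i) 0 with hi | hi | hi
    · rw [hx _ hi _ (h i), zero_smul]; exact Submodule.zero_mem _
    · refine Submodule.smul_mem _ _ (Submodule.mem_sup_left ?_)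
      rw [LinearMap.mem_ker, h, hi, zero_smul]
    · exact Submodule.smul_mem _ _ (Submodule.mem_sup_right (mem_upper_of_eigen hi (h i)))
  obtain ⟨z, hz, u, hu, rfl⟩ := Submodule.mem_sup.1 hmem
  exact ⟨z, u, hz, hu, rfl⟩

/-- Sort an eigenbasis of `ad q` by the sign of the eigenvalue; `θ` exchanges positive and negative.
-/
theorem exists_triangular_decomposition (H : CartanBracket br θ) {q : E} (hq : θ q = -q) (x : E) :
    ∃ z u v, br q z = 0 ∧ u ∈ upper br q 0 ∧ v ∈ upper br q 0 ∧ x = z + u + θ v := by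
  obtain ⟨e, l, h⟩ := (H.isSymmetric_br hq).exists_orthonormalBasis_eigen
  have hmem : x ∈ (LinearMap.ker (br q) ⊔ upper br q 0) ⊔ (upper br q 0).map θ := by
    rw [← e.sum_repr' x]
    refine Submodule.sum_mem _ fun i _ => Submodule.smul_mem _ _ ?_
    rcases lt_trichotomy (l i) 0 with hi | hi | hi
    · exact Submodule.mem_sup_right
        ⟨θ (e i), mem_upper_of_eigen (neg_pos.2 hi) (H.theta_eigen hq (h i)), H.theta_theta _⟩
    · refine Submodule.mem_sup_left (Submodule.mem_sup_left ?_)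
      rw [LinearMap.mem_ker, h, hi, zero_smul]
    · exact Submodule.mem_sup_left (Submodule.mem_sup_right (mem_upper_of_eigen hi (h i)))
  obtain ⟨_, hy, _, ⟨v, hv, rfl⟩, rfl⟩ := Submodule.mem_sup.1 hmem
  obtain ⟨z, hz, u, hu, rfl⟩ := Submodule.mem_sup.1 hy
  exact ⟨z, u, v, hz, hu, hv, rfl⟩

/-- A `θ`-fixed element of the centralizer of `q` acts faithfully on the nilradical. -/
theorem eq_zero_of_br_upper_eq_zero (H : CartanBracket br θ) {q k : E} (hq : θ q = -q)
    (hq0 : q ≠ 0) (hk : θ k = k) (hkq : br q k = 0) (hku : ∀ u ∈ upper br q 0, br k u = 0) :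
    k = 0 := by
  refine H.faithful k hk fun p hp => ?_
  obtain ⟨z, u, v, hz, hu, hv, hpe⟩ := H.exists_triangular_decomposition hq p
  have hθ : ∀ u ∈ upper br q 0, br k (θ u) = 0 := by
    intro u hu
    rw [← hk, ← H.theta_br, hku u hu, map_zero]
  obtain ⟨c, hc, -⟩ := H.exists_sub_smul_fixed hq hq0 hz
  -- Applying `(1 - θ) / 2`, which fixes `p`, to the triangular decomposition leaves only terms
  -- annihilated by `k`.
  have h1 : p = (1 / 2 : ℝ) • (c • q + (u - θ u) + (θ v - v)) := by
    have h2 : θ p = θ z + θ u + v := by rw [hpe, map_add, map_add, H.theta_theta]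
    have h3 : p = (1 / 2 : ℝ) • (p - θ p) := by rw [hp]; module
    rw [h3, h2, hpe, ← hc]
    module
  rw [h1, map_smul, map_add, map_add, map_sub, map_sub, map_smul, hku u hu, hku v hv, hθ u hu,
    hθ v hv, H.br_swap k q, hkq]
  simp

/-- The map `(u, c) ↦ u - θ u + c q` lands in 𝔭. It is injective: pairing its value with `u` gives
`⟪u, u⟫`, since both `θ u'` and `q` are orthogonal to the nilradical. -/
theorem finrank_upper_add_one_le (H : CartanBracket br θ) {q : E} (hq : θ q = -q) (hq0 : q ≠ 0) :
    finrank ℝ (upper br q 0) + 1 ≤ finrank ℝ (pSpace θ) := by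
  let f : upper br q 0 × ℝ →ₗ[ℝ] pSpace θ :=
    LinearMap.codRestrict _
      (((LinearMap.id - θ) ∘ₗ (upper br q 0).subtype).coprod (LinearMap.toSpanSingleton ℝ E q))
      (by
        rintro ⟨u, c⟩
        rw [mem_pSpace]
        simp only [LinearMap.coprod_apply, LinearMap.comp_apply, LinearMap.sub_apply,
          LinearMap.id_apply, Submodule.subtype_apply, LinearMap.toSpanSingleton_apply, map_add,
          map_sub, map_smul, H.theta_theta, hq]
        module)
  have hf : Function.Injective f := by
    rw [injective_iff_map_eq_zero]
    rintro ⟨u, c⟩ h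
    have h0 : (u : E) - θ u + c • q = 0 := by
      have := congrArg Subtype.val h
      simpa [f] using this
    have h1 : ⟪(u : E), (u : E) - θ u + c • q⟫_ℝ = 0 := by rw [h0, inner_zero_right]
    have h2 : ⟪q, (u : E)⟫_ℝ = 0 :=
      H.inner_eigen_upper hq le_rfl (by rw [H.br_self, zero_smul]) u.2
    rw [inner_add_right, inner_sub_right, real_inner_comm (θ (u : E)),
      H.inner_theta_upper hq u.2 u.2, inner_smul_right, real_inner_comm q, h2, mul_zero, sub_zero,
      add_zero] at h1
    have hu : (u : E) = 0 := inner_self_eq_zero.1 h1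
    rw [hu, map_zero, sub_zero, zero_add] at h0
    have hc : c = 0 := (smul_eq_zero.1 h0).resolve_right hq0
    exact Prod.ext (Subtype.ext hu) hc
  have := LinearMap.finrank_le_finrank_of_injective hf
  simpa using this

/-- Elements of the nilradical are nilpotent. -/
theorem isNilpotent_br_of_mem_upper (H : CartanBracket br θ) {q b : E} (hq : θ q = -q)
    (hb : b ∈ upper br q 0) : IsNilpotent (br b) := by
  -- Only finitely many eigenvalues contribute to `b`, so they stay away from 0.
  obtain ⟨ε, hε, hbε⟩ : ∃ ε : ℝ, 0 < ε ∧ b ∈ upper br q ε := by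
    refine Submodule.iSup_induction (p := fun a : ℝ => ⨆ (_ : 0 < a), End.eigenspace (br q) a)
      (motive := fun b => ∃ ε : ℝ, 0 < ε ∧ b ∈ upper br q ε) hb ?_ ?_ ?_
    · intro a x hx
      by_cases ha : 0 < a
      · rw [iSup_pos ha, End.mem_eigenspace_iff] at hx
        exact ⟨a / 2, by positivity, mem_upper_of_eigen (by linarith) hx⟩
      · rw [iSup_neg ha, Submodule.mem_bot] at hx
        exact ⟨1, one_pos, by rw [hx]; exact Submodule.zero_mem _⟩
    · exact ⟨1, one_pos, Submodule.zero_mem _⟩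
    · rintro x y ⟨ε, hε, hx⟩ ⟨δ, hδ, hy⟩
      exact ⟨min ε δ, lt_min hε hδ, Submodule.add_mem _ (upper_antitone (min_le_left _ _) hx)
        (upper_antitone (min_le_right _ _) hy)⟩
  obtain ⟨e, l, h⟩ := (H.isSymmetric_br hq).exists_orthonormalBasis_eigen
  obtain ⟨M, hM⟩ : ∃ M : ℝ, ∀ i, |l i| < M := by
    obtain ⟨M, hM⟩ := (Set.finite_range fun i => |l i|).bddAbove
    exact ⟨M + 1, fun i => by linarith [hM ⟨i, rfl⟩]⟩
  -- All eigenvalues of `ad q` lie in `(-M, M)` and each application of `ad b` raises the filtration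
  -- by `ε`; after `2M / ε` steps nothing is left.
  obtain ⟨k, hk⟩ := exists_nat_ge (2 * M / ε)
  have hpow : ∀ (j : ℕ) (x : E), (br b ^ j) x ∈ upper br q (-M + j * ε) := by
    intro j x
    induction j with
    | zero =>
      rw [pow_zero, End.one_apply, ← e.sum_repr' x]
      refine Submodule.sum_mem _ fun i _ => Submodule.smul_mem _ _ (mem_upper_of_eigen ?_ (h i))
      have := (abs_lt.1 (hM i)).1
      push_cast
      linarith
    | succ j ih =>
      rw [pow_succ', Module.End.mul_apply]
      have := H.br_upper_upper hbε ih
      convert! this using 2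
      push_cast
      ring
  refine ⟨k, ?_⟩
  ext x
  have h1 := hpow k x
  have hk' : M ≤ -M + k * ε := by
    rw [div_le_iff₀ hε] at hk
    linarith
  rw [LinearMap.zero_apply, ← e.sum_repr' ((br b ^ k) x)]
  refine Finset.sum_eq_zero fun i _ => ?_
  rw [H.inner_eigen_upper hq (((abs_lt.1 (hM i)).2.le).trans hk') (h i) h1, zero_smul]

/-- A commutative subspace of `θ`-fixed elements of the centralizer of `q` has dimension at most
half the codimension of its common kernel on the nilradical. -/
theorem two_mul_finrank_add_finrank_le (H : CartanBracket br θ) {q : E} (hq : θ q = -q)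
    (hq0 : q ≠ 0) (C : Submodule ℝ E) (hC : ∀ c ∈ C, br q c = 0) (hCθ : ∀ c ∈ C, θ c = c)
    (hab : ∀ c ∈ C, ∀ d ∈ C, br c d = 0) :
    2 * finrank ℝ C + finrank ℝ (upper br q 0 ⊓ ⨅ c : C, LinearMap.ker (br c) : Submodule ℝ E) ≤
      finrank ℝ (upper br q 0) := by
  let ρ : C →ₗ[ℝ] upper br q 0 →ₗ[ℝ] upper br q 0 :=
    { toFun := fun c => (br c).restrict fun x hx => H.br_centralizer_upper (hC c c.2) hx
      map_add' := by intro a b; ext x; simp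
      map_smul' := by intro a b; ext x; simp }
  have key := two_mul_finrank_add_finrank_ker_le_of_skew (finrank ℝ C) ρ rfl
    (fun c x y => H.inner_br_of_fixed (hCθ c c.2) x y)
    (fun c d x => Subtype.ext (by
      change br c (br d x) = br d (br c x)
      rw [H.jacobi, hab c c.2 d d.2, map_zero, LinearMap.zero_apply, zero_add]))
    (fun c hc => Subtype.ext (H.eq_zero_of_br_upper_eq_zero hq hq0 (hCθ c c.2) (hC c c.2)
      fun u hu => congrArg Subtype.val (LinearMap.congr_fun hc ⟨u, hu⟩)))
  have hle : (upper br q 0 ⊓ ⨅ c : C, LinearMap.ker (br c) : Submodule ℝ E) ≤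
      (⨅ c, LinearMap.ker (ρ c) : Submodule ℝ (upper br q 0)).map (upper br q 0).subtype := by
    rintro x ⟨hx, hxc⟩
    refine ⟨⟨x, hx⟩, ?_, rfl⟩
    simp only [Submodule.coe_iInf, Set.mem_iInter, SetLike.mem_coe, LinearMap.mem_ker] at hxc ⊢
    exact fun c => Subtype.ext (hxc c)
  have := (Submodule.finrank_mono hle).trans (Submodule.finrank_map_le _ _)
  omega

/-- A commutative subspace of the centralizer of a nonzero `q ∈ 𝔭` is small. -/
theorem two_mul_finrank_le_of_centralizer (H : CartanBracket br θ) {q : E} (hq : θ q = -q)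
    (hq0 : q ≠ 0) (C : Submodule ℝ E) (hC : ∀ c ∈ C, br q c = 0)
    (hab : ∀ c ∈ C, ∀ d ∈ C, br c d = 0) :
    2 * finrank ℝ C ≤ 2 + finrank ℝ (upper br q 0) := by
  -- Rank one puts the range of `1 - θ` on `C` in the line of `q`; its kernel is θ-fixed, so the
  -- skew bound applies there.
  let f : C →ₗ[ℝ] E := (LinearMap.id - θ) ∘ₗ C.subtype
  have hf : ∀ c : C, f c = c - θ c := fun c => rfl
  have h1 := LinearMap.finrank_range_add_finrank_ker f
  have h2 : finrank ℝ (LinearMap.range f) ≤ 1 := by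
    refine (Submodule.finrank_mono (?_ : _ ≤ Submodule.span ℝ {q})).trans
      (finrank_span_singleton hq0).le
    rintro _ ⟨c, rfl⟩
    obtain ⟨a, ha, -⟩ := H.exists_sub_smul_fixed hq hq0 (hC c c.2)
    rw [hf, ha]
    exact Submodule.smul_mem _ _ (Submodule.mem_span_singleton_self q)
  have h3 := H.two_mul_finrank_add_finrank_le hq hq0 ((LinearMap.ker f).map C.subtype)
    (by rintro _ ⟨c, -, rfl⟩; exact hC c c.2)
    (by rintro _ ⟨c, hc, rfl⟩; exact (sub_eq_zero.1 hc).symm)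
    (by rintro _ ⟨c, -, rfl⟩ _ ⟨d, -, rfl⟩; exact hab c c.2 d d.2)
  rw [Submodule.finrank_map_subtype_eq] at h3
  omega

end CartanBracket

/-! ### Dimension bounds for commutative subspaces -/

namespace CartanBracket

variable {E : Type*} [NormedAddCommGroup E] [InnerProductSpace ℝ E]
  {br : E →ₗ[ℝ] E →ₗ[ℝ] E} {θ : E →ₗ[ℝ] E} [FiniteDimensional ℝ E]

/-- The dimension bound for commutative subspaces of a parabolic subalgebra which are not contained
in the nilradical. -/
theorem finrank_le_of_parabolic (H : CartanBracket br θ) {q : E} (hq : θ q = -q) (hq0 : q ≠ 0)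
    (𝔟 : Submodule ℝ E) (hab : ∀ x ∈ 𝔟, ∀ y ∈ 𝔟, br x y = 0)
    (hpar : ∀ b ∈ 𝔟, ∃ z u, br q z = 0 ∧ u ∈ upper br q 0 ∧ b = z + u)
    (hnil : ∃ b ∈ 𝔟, ¬ IsNilpotent (br b)) :
    finrank ℝ 𝔟 + 1 ≤ finrank ℝ (upper br q 0) ∨
      2 * finrank ℝ 𝔟 ≤ 2 + finrank ℝ (upper br q 0) := by
  set Z : Submodule ℝ E := LinearMap.ker (br q) with hZ
  -- Since the nilradical is orthogonal to the centralizer of `q`, orthogonal projection picks out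
  -- the Levi component.
  let f : 𝔟 →ₗ[ℝ] E := Z.starProjection.toLinearMap ∘ₗ 𝔟.subtype
  have hfZ : ∀ b : 𝔟, br q (f b) = 0 := fun b => Z.starProjection_apply_mem (b : E)
  have hfu : ∀ b : 𝔟, ∃ u ∈ upper br q 0, (b : E) = f b + u := by
    intro b
    obtain ⟨z, u, hz, hu, hb⟩ := hpar b b.2
    refine ⟨u, hu, ?_⟩
    have : f b = z := by
      change Z.starProjection (b : E) = z
      refine Submodule.eq_starProjection_of_mem_orthogonal (K := Z) hz ?_
      rw [hb, add_sub_cancel_left, Submodule.mem_orthogonal]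
      intro w hw
      exact H.inner_eigen_upper hq le_rfl (by rw [zero_smul]; exact hw) hu
    rw [this, hb]
  have hker : ∀ b : 𝔟, f b = 0 → (b : E) ∈ upper br q 0 := by
    intro b hb
    obtain ⟨u, hu, hbu⟩ := hfu b
    rw [hbu, hb, zero_add]
    exact hu
  have hCab : ∀ c ∈ LinearMap.range f, ∀ d ∈ LinearMap.range f, br c d = 0 := by
    rintro _ ⟨b, rfl⟩ _ ⟨b', rfl⟩
    obtain ⟨u, hu, hbu⟩ := hfu b
    obtain ⟨u', hu', hbu'⟩ := hfu b'
    have h0 := hab b b.2 b' b'.2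
    rw [hbu, hbu', LinearMap.map_add₂, map_add, map_add] at h0
    have h1 : br (f b) u' ∈ upper br q 0 := H.br_centralizer_upper (hfZ b) hu'
    have h2 : br u (f b') ∈ upper br q 0 := by
      rw [H.br_swap]
      exact Submodule.neg_mem _ (H.br_centralizer_upper (hfZ b') hu)
    have h3 : br u u' ∈ upper br q 0 := by
      have := H.br_upper_upper hu hu'
      rwa [zero_add] at this
    have h4 : br (f b) (f b') = -(br (f b) u' + (br u (f b') + br u u')) := by
      rw [eq_neg_iff_add_eq_zero, ← add_assoc]
      exact h0
    have h5 : br (f b) (f b') ∈ upper br q 0 := by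
      rw [h4]
      exact Submodule.neg_mem _ (Submodule.add_mem _ h1 (Submodule.add_mem _ h2 h3))
    have h6 : br q (br (f b) (f b')) = (0 : ℝ) • br (f b) (f b') := by
      rw [H.jacobi, hfZ, hfZ]
      simp
    exact inner_self_eq_zero.1 (H.inner_eigen_upper hq le_rfl h6 h5)
  have hCZ : ∀ c ∈ LinearMap.range f, br q c = 0 := by
    rintro _ ⟨b, rfl⟩
    exact hfZ b
  have hlead : ∀ (n : 𝔟), f n = 0 → (n : E) ≠ 0 → ∃ a u v, 0 < a ∧ u ≠ 0 ∧ br q u = a • u ∧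
      v ∈ upper br q a ∧ (n : E) = u + v ∧ ∀ b : 𝔟, br (f b) u = 0 := by
    intro n hn hn0
    obtain ⟨a, u, v, ha, hu0, hu, hv, hnuv⟩ := H.exists_leading hq (hker n hn) hn0
    refine ⟨a, u, v, ha, hu0, hu, hv, hnuv, fun b => ?_⟩
    obtain ⟨x, hx, hbx⟩ := hfu b
    refine H.br_leading_eq_zero hq (hfZ b) hx hu hv ?_
    rw [← hbx, ← hnuv]
    exact hab b b.2 n n.2
  have hsum := LinearMap.finrank_range_add_finrank_ker f
  by_cases hfix : ∀ c ∈ LinearMap.range f, θ c = c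
  · left
    have h1 := H.two_mul_finrank_add_finrank_le hq hq0 (LinearMap.range f) hCZ hfix hCab
    set K : Submodule ℝ E :=
      upper br q 0 ⊓ ⨅ c : LinearMap.range f, LinearMap.ker (br c) with hK
    -- Project `ker f` orthogonally to `K`. The leading term `u` of a nonzero `n` lies in `K` and
    -- `⟪u, n⟫ = ⟪u, u⟫`, so the projection does not vanish on `n`.
    have h2 : finrank ℝ (LinearMap.ker f) ≤ finrank ℝ K := by
      let g : LinearMap.ker f →ₗ[ℝ] K :=
        K.orthogonalProjectionOnto.toLinearMap ∘ₗ 𝔟.subtype ∘ₗ (LinearMap.ker f).subtype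
      refine LinearMap.finrank_le_finrank_of_injective (f := g) ?_
      rw [injective_iff_map_eq_zero]
      intro n hn
      by_contra hne
      have hn0 : ((n : 𝔟) : E) ≠ 0 := fun h => hne (Subtype.ext (Subtype.ext h))
      obtain ⟨a, u, v, ha, hu0, hu, hv, hnuv, hub⟩ := hlead n n.2 hn0
      have huK : u ∈ K := by
        refine ⟨mem_upper_of_eigen ha hu, ?_⟩
        simp only [Submodule.coe_iInf, Set.mem_iInter, SetLike.mem_coe, LinearMap.mem_ker]
        rintro ⟨_, b, rfl⟩
        exact hub b
      have hperp : ((n : 𝔟) : E) ∈ Kᗮ :=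
        Submodule.orthogonalProjectionOnto_eq_zero_iff.1 hn
      have h3 := Submodule.mem_orthogonal _ _ |>.1 hperp u huK
      rw [hnuv, inner_add_right, H.inner_eigen_upper hq le_rfl hu hv, add_zero] at h3
      exact hu0 (inner_self_eq_zero.1 h3)
    have h3 : 1 ≤ finrank ℝ (LinearMap.range f) := by
      rw [Nat.one_le_iff_ne_zero, Ne, Submodule.finrank_eq_zero, LinearMap.range_eq_bot]
      intro h0
      obtain ⟨b, hb, hbn⟩ := hnil
      exact hbn (H.isNilpotent_br_of_mem_upper hq (hker ⟨b, hb⟩ (by rw [h0]; rfl)))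
    omega
  · right
    push Not at hfix
    obtain ⟨_, ⟨b, rfl⟩, hbθ⟩ := hfix
    obtain ⟨c, hc, hcθ⟩ := H.exists_sub_smul_fixed hq hq0 (hfZ b)
    have hc0 : c ≠ 0 := by
      rintro rfl
      rw [zero_smul, sub_eq_zero] at hc
      exact hbθ hc.symm
    have hbot : LinearMap.ker f = ⊥ := by
      rw [LinearMap.ker_eq_bot']
      intro n hn
      by_contra hne
      obtain ⟨a, u, v, ha, hu0, hu, -, -, hub⟩ := hlead n hn fun h => hne (Subtype.ext h)
      -- `k` is θ-fixed, hence skew, yet `[f b, u] = 0` would give it the nonzero real eigenvalue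
      -- `-c a / 2` on `u`.
      set k := f b - (1 / 2 * c) • q with hk
      have h1 : br k u = -((1 / 2 * c * a) • u) := by
        rw [hk, LinearMap.map_sub₂, hub, LinearMap.map_smul₂, hu, zero_sub, smul_smul]
      have h2 := H.inner_br_of_fixed hcθ u u
      rw [h1, inner_neg_left, inner_neg_right, inner_smul_left, inner_smul_right, conj_trivial,
        neg_neg] at h2
      have h3 : (c * a) * ⟪u, u⟫_ℝ = 0 := by linarith
      exact (mul_ne_zero (mul_ne_zero hc0 ha.ne') fun h => hu0 (inner_self_eq_zero.1 h)) h3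
    rw [hbot, finrank_bot, add_zero] at hsum
    rw [← hsum]
    exact H.two_mul_finrank_le_of_centralizer hq hq0 _ hCZ hCab

/-- The dimension bound for commutative subspaces of `θ`-fixed elements. -/
theorem two_mul_finrank_le_of_fixed (H : CartanBracket br θ) (C : Submodule ℝ E)
    (hCθ : ∀ c ∈ C, θ c = c) (hab : ∀ c ∈ C, ∀ d ∈ C, br c d = 0) :
    2 * finrank ℝ C ≤ finrank ℝ (pSpace θ) := by
  have hinv : ∀ c ∈ C, ∀ x ∈ pSpace θ, br c x ∈ pSpace θ := by
    intro c hc x hx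
    rw [mem_pSpace] at hx ⊢
    rw [H.theta_br, hCθ c hc, hx, map_neg]
  let ρ : C →ₗ[ℝ] pSpace θ →ₗ[ℝ] pSpace θ :=
    { toFun := fun c => (br c).restrict (hinv c c.2)
      map_add' := by intro a b; ext x; simp
      map_smul' := by intro a b; ext x; simp }
  have key := two_mul_finrank_add_finrank_ker_le_of_skew (finrank ℝ C) ρ rfl
    (fun c x y => H.inner_br_of_fixed (hCθ c c.2) x y)
    (fun c d x => Subtype.ext (by
      change br c (br d x) = br d (br c x)
      rw [H.jacobi, hab c c.2 d d.2, map_zero, LinearMap.zero_apply, zero_add]))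
    (fun c hc => Subtype.ext (H.faithful c (hCθ c c.2)
      fun p hp => congrArg Subtype.val (LinearMap.congr_fun hc ⟨p, mem_pSpace.2 hp⟩)))
  omega

/-- The dimension bound for commutative subspaces spanned by a family with vanishing moment map. -/
theorem two_mul_finrank_le_of_balanced (H : CartanBracket br θ) (C : Submodule ℝ E)
    (hab : ∀ c ∈ C, ∀ d ∈ C, br c d = 0) (hθ : ∀ c ∈ C, ∀ d ∈ C, br (θ c) d = 0) :
    2 * finrank ℝ C ≤ finrank ℝ (pSpace θ) + 1 := by
  by_cases hfix : ∀ c ∈ C, θ c = c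
  · have := H.two_mul_finrank_le_of_fixed C hfix hab
    omega
  · push Not at hfix
    obtain ⟨c, hc, hcθ⟩ := hfix
    have hq : θ (c - θ c) = -(c - θ c) := by rw [map_sub, H.theta_theta, neg_sub]
    have hq0 : c - θ c ≠ 0 := sub_ne_zero.2 hcθ.symm
    have h1 := H.two_mul_finrank_le_of_centralizer hq hq0 C
      (fun d hd => by rw [LinearMap.map_sub₂, hab c hc d hd, hθ c hc d hd, sub_zero]) hab
    have h2 := H.finrank_upper_add_one_le hq hq0
    omega

/-- A commutative subalgebra with a non-nilpotent element has dimension at most `dim 𝔭 - 2`, unless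
its dimension is at most two. -/
theorem finrank_le_of_not_isNilpotent (H : CartanBracket br θ) (𝔟 : Submodule ℝ E)
    (hab : ∀ x ∈ 𝔟, ∀ y ∈ 𝔟, br x y = 0) (hnil : ∃ b ∈ 𝔟, ¬ IsNilpotent (br b)) :
    finrank ℝ 𝔟 ≤ max 2 (finrank ℝ (pSpace θ) - 2) := by
  let e := finBasis ℝ 𝔟
  let b : Fin (finrank ℝ 𝔟) → E := fun i => (e i : E)
  have hspan : ∀ P : Submodule ℝ E, (∀ i, b i ∈ P) → 𝔟 ≤ P := by
    intro P hP x hx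
    have h1 := congrArg Subtype.val (e.sum_repr ⟨x, hx⟩)
    rw [← show _ = x from h1, Submodule.coe_sum]
    exact Submodule.sum_mem _ fun i _ => Submodule.smul_mem _ _ (hP i)
  rcases H.exists_min_or_parabolic b with ⟨p₀, hp₀, hmin⟩ | ⟨q, hq, hq0, hpar⟩
  · obtain ⟨R, hR, hRbr, hbal⟩ := H.exists_balanced_of_min b hp₀ hmin
    have hRab : ∀ x ∈ 𝔟, ∀ y ∈ 𝔟, br (R x) (R y) = 0 := by
      intro x hx y hy
      rw [← hRbr, hab x hx y hy, map_zero]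
    have hcomm := H.br_theta_eq_zero_of_balanced (fun i => R (b i))
      (fun i j => hRab _ (e i).2 _ (e j).2) hbal
    have h1 : ∀ j, ∀ x ∈ 𝔟, br (θ (R x)) (R (b j)) = 0 := fun j x hx =>
      hspan (LinearMap.ker (br.flip (R (b j)) ∘ₗ θ ∘ₗ R)) (fun i => hcomm i j) hx
    have h2 : ∀ x ∈ 𝔟, ∀ y ∈ 𝔟, br (θ (R x)) (R y) = 0 := fun x hx y hy =>
      hspan (LinearMap.ker (br (θ (R x)) ∘ₗ R)) (fun j => h1 j x hx) hy
    have h3 := H.two_mul_finrank_le_of_balanced (𝔟.map R)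
      (by rintro _ ⟨x, hx, rfl⟩ _ ⟨y, hy, rfl⟩; exact hRab x hx y hy)
      (by rintro _ ⟨x, hx, rfl⟩ _ ⟨y, hy, rfl⟩; exact h2 x hx y hy)
    rw [← (𝔟.equivMapOfInjective R hR).finrank_eq] at h3
    -- From `2d ≤ dim 𝔭 + 1` one gets `d ≤ dim 𝔭 - 2` when `dim 𝔭 ≥ 4`, and `d ≤ 2` for smaller 𝔭;
    -- hence the maximum with 2.
    omega
  · have h1 : ∀ x ∈ 𝔟, ∃ z u, br q z = 0 ∧ u ∈ upper br q 0 ∧ x = z + u := by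
      intro x hx
      refine H.exists_parabolic_decomposition hq fun a ha w hw => ?_
      exact hspan (LinearMap.ker (innerₛₗ ℝ w)) (fun i => hpar a ha w hw i) hx
    have h2 := H.finrank_le_of_parabolic hq hq0 𝔟 hab h1 hnil
    have h3 := H.finrank_upper_add_one_le hq hq0
    omega

end CartanBracket

/-! ### From simple real Lie algebras to the Cartan data -/

section LieAlgebra

variable {L : Type*} [LieRing L] [LieAlgebra ℝ L]

/-- The inner product `(x, y) ↦ -κ(x, θ y)` defined by a Cartan involution `θ`. -/
noncomputable abbrev cartanCore (θ : L ≃ₗ⁅ℝ⁆ L) (hinv : ∀ x, θ (θ x) = x)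
    (hpos : ∀ x, x ≠ 0 → 0 < -killingForm ℝ L x (θ x)) : InnerProductSpace.Core ℝ L where
  inner x y := -killingForm ℝ L x (θ y)
  conj_inner_symm x y := by
    have h := LieAlgebra.killingForm_of_equiv_apply θ x (θ y)
    rw [hinv, LieModule.traceForm_comm] at h
    rw [conj_trivial, h]
  re_inner_nonneg x := by
    rcases eq_or_ne x 0 with rfl | hx
    · simp
    · exact (hpos x hx).le
  add_left x y z := by
    rw [LinearMap.map_add₂, neg_add]
  smul_left x y r := by
    rw [LinearMap.map_smul₂, conj_trivial, smul_eq_mul, mul_neg]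
  definite x hx := by
    by_contra h
    exact (hpos x h).ne' hx

/-- The bracket of a Lie algebra as a bilinear map. -/
noncomputable abbrev lieBilin (L : Type*) [LieRing L] [LieAlgebra ℝ L] : L →ₗ[ℝ] L →ₗ[ℝ] L :=
  LinearMap.mk₂ ℝ (fun x y => ⁅x, y⁆) add_lie smul_lie lie_add fun c x y => lie_smul c x y

theorem isKilling_of_cartan (θ : L ≃ₗ⁅ℝ⁆ L)
    (hpos : ∀ x, x ≠ 0 → 0 < -killingForm ℝ L x (θ x)) : LieAlgebra.IsKilling ℝ L := by
  constructor
  rw [eq_bot_iff]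
  intro x hx
  rw [LieIdeal.mem_killingCompl] at hx
  by_contra h
  have h1 := hpos x h
  have h2 := hx (θ x) (by trivial)
  rw [LieModule.traceForm_comm] at h2
  rw [h2] at h1
  simp at h1

theorem eq_zero_of_forall_lie_eq_zero (θ : L ≃ₗ⁅ℝ⁆ L)
    (hpos : ∀ x, x ≠ 0 → 0 < -killingForm ℝ L x (θ x)) {x : L} (hx : ∀ y : L, ⁅x, y⁆ = 0) :
    x = 0 := by
  by_contra h
  have h1 := hpos x h
  have h2 : LieAlgebra.ad ℝ L x = 0 := by
    ext y
    exact hx y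
  rw [killingForm_apply_apply, h2] at h1
  simp at h1

/-- The elements of `𝔨` acting trivially on `𝔭` form an ideal. -/
def isotropyKernel (θ : L ≃ₗ⁅ℝ⁆ L) (hinv : ∀ x, θ (θ x) = x) : LieIdeal ℝ L where
  carrier := {k | θ k = k ∧ ∀ p, θ p = -p → ⁅k, p⁆ = 0}
  add_mem' := by
    rintro a b ⟨ha, ha'⟩ ⟨hb, hb'⟩
    refine ⟨by rw [map_add, ha, hb], fun p hp => ?_⟩
    rw [add_lie, ha' p hp, hb' p hp, add_zero]
  zero_mem' := ⟨map_zero _, fun p _ => zero_lie p⟩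
  smul_mem' := by
    rintro c a ⟨ha, ha'⟩
    refine ⟨by rw [map_smul, ha], fun p hp => ?_⟩
    rw [smul_lie, ha' p hp, smul_zero]
  lie_mem := by
    rintro x k ⟨hk, hk'⟩
    -- `x - θ x` lies in 𝔭, which `k` kills, so `ad x` and `ad (θ x)` agree on `k` and `x` may be
    -- replaced by its θ-fixed part.
    have hxm : ⁅x - θ x, k⁆ = 0 := by
      rw [← lie_skew, hk' _ (by rw [map_sub, hinv, neg_sub]), neg_zero]
    have hx2 : ⁅x, k⁆ = ⁅θ x, k⁆ := by rwa [sub_lie, sub_eq_zero] at hxm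
    refine ⟨?_, fun p hp => ?_⟩
    · rw [LieEquiv.map_lie, hk, hx2]
    · have h1 : ⁅⁅x + θ x, k⁆, p⁆ = 0 := by
        have h2 : ⁅⁅x + θ x, k⁆, p⁆ = ⁅x + θ x, ⁅k, p⁆⁆ - ⁅k, ⁅x + θ x, p⁆⁆ := lie_lie _ _ _
        rw [h2, hk' p hp, hk' ⁅x + θ x, p⁆, lie_zero, sub_zero]
        rw [LieEquiv.map_lie, map_add, hinv, hp, lie_neg, add_comm]
      rw [add_lie, ← hx2, ← two_smul ℝ, smul_lie] at h1
      exact (smul_eq_zero.1 h1).resolve_left two_ne_zero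

/-- The dimension bound in a simple Lie algebra of real rank one. -/
theorem finrank_le_of_lie_not_isNilpotent [FiniteDimensional ℝ L]
    (hsimple : LieAlgebra.IsSimple ℝ L)
    (θ : L ≃ₗ⁅ℝ⁆ L) (hinv : ∀ x, θ (θ x) = x)
    (hpos : ∀ x, x ≠ 0 → 0 < -killingForm ℝ L x (θ x))
    (hrank : ∀ x y, θ x = -x → θ y = -y → ⁅x, y⁆ = 0 → x ≠ 0 → ∃ c : ℝ, y = c • x)
    (hp : ∃ p : L, p ≠ 0 ∧ θ p = -p) (P : Submodule ℝ L) (hP : ∀ x, x ∈ P ↔ θ x = -x)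
    (𝔟 : Submodule ℝ L) (hab : ∀ x ∈ 𝔟, ∀ y ∈ 𝔟, ⁅x, y⁆ = 0)
    (hnil : ∃ b ∈ 𝔟, ¬ IsNilpotent (LieAlgebra.ad ℝ L b)) :
    finrank ℝ 𝔟 ≤ max 2 (finrank ℝ P - 2) := by
  have hK := isKilling_of_cartan θ hpos
  let core := cartanCore θ hinv hpos
  let : NormedAddCommGroup L := core.toNormedAddCommGroup
  let : InnerProductSpace ℝ L := InnerProductSpace.ofCore core.toCore
  have hin : ∀ x y : L, ⟪x, y⟫_ℝ = -killingForm ℝ L x (θ y) := fun _ _ => rfl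
  have H : CartanBracket (E := L) (lieBilin L) (θ : L →ₗ[ℝ] L) :=
    { br_self := fun x => lie_self x
      jacobi := fun x y z => leibniz_lie x y z
      theta_theta := hinv
      theta_br := fun x y => LieEquiv.map_lie θ x y
      inner_br := by
        intro x y z
        rw [hin, hin]
        change -killingForm ℝ L ⁅x, y⁆ (θ z) = - -killingForm ℝ L y (θ ⁅θ x, z⁆)
        rw [LieEquiv.map_lie, hinv, ← lie_skew x y, LinearMap.map_neg₂,
          LieModule.traceForm_apply_lie_apply]
      inner_derivation := by
        intro D hD
        let D' : LieDerivation ℝ L L :=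
          { toLinearMap := D
            leibniz' := by
              intro a b
              change D ⁅a, b⁆ = ⁅a, D b⁆ - ⁅b, D a⁆
              have h1 : D ⁅a, b⁆ = ⁅D a, b⁆ + ⁅a, D b⁆ := hD a b
              rw [h1, ← lie_skew b (D a)]
              abel }
        obtain ⟨x, hx⟩ := LieDerivation.IsKilling.exists_eq_ad D'
        refine ⟨x, ?_⟩
        ext y
        have h1 := congrArg (fun F : LieDerivation ℝ L L => F y) hx
        simp only [LieDerivation.ad_apply_apply] at h1
        exact h1
      center := fun x hx => eq_zero_of_forall_lie_eq_zero θ hpos fun y => LinearMap.congr_fun hx y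
      faithful := by
        intro k hk hkp
        have hmem : k ∈ isotropyKernel θ hinv := ⟨hk, hkp⟩
        -- By simplicity the isotropy kernel is 0 or everything; the latter would make the nonzero
        -- `p ∈ 𝔭` fixed by `θ`.
        rcases hsimple.eq_bot_or_eq_top (isotropyKernel θ hinv) with h | h
        · rw [h] at hmem
          exact (LieSubmodule.mem_bot _).1 hmem
        · obtain ⟨p, hp0, hpθ⟩ := hp
          have hpm : p ∈ isotropyKernel θ hinv := by rw [h]; trivial
          have h1 : p = -p := hpm.1.symm.trans hpθ
          have h2 : (2 : ℝ) • p = 0 := by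
            rw [two_smul]
            exact eq_neg_iff_add_eq_zero.1 h1
          exact absurd ((smul_eq_zero.1 h2).resolve_left two_ne_zero) hp0
      rank_one := hrank }
  have key := H.finrank_le_of_not_isNilpotent 𝔟 hab hnil
  have hPe : CartanBracket.pSpace (θ : L →ₗ[ℝ] L) = P := by
    ext x
    rw [CartanBracket.mem_pSpace, hP]
    rfl
  rwa [hPe] at key

end LieAlgebra

end

section

open scoped Topology

/-! ### The derivative of conjugation in a local group law -/

section Calculus

variable {E : Type*} [NormedAddCommGroup E] [NormedSpace ℝ E]

/-- The derivative of the adjoint action in a local chart: if `μ` is a local group law with unit `c`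
and `F (y, x) = y x y⁻¹`, then the derivative of `y ↦ ∂₂F(y, c) w` is the Lie bracket of the left
invariant vector fields. -/
theorem fderiv_conj_eq_lieBracket {μ F : E × E → E} {c : E} (hμ : ContDiffAt ℝ 2 μ (c, c))
    (hF : ContDiffAt ℝ 2 F (c, c)) (hμ1 : ∀ᶠ y in 𝓝 c, μ (y, c) = y)
    (hμ2 : ∀ᶠ y in 𝓝 c, μ (c, y) = y) (hF1 : ∀ᶠ y in 𝓝 c, F (y, c) = c)
    (hF2 : ∀ᶠ x in 𝓝 c, F (c, x) = x) (hμF : ∀ᶠ p in 𝓝 (c, c), μ (F p, p.1) = μ p) (w : E) :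
    DifferentiableAt ℝ (fun y => fderiv ℝ F (y, c) (0, w)) c ∧
    ∀ v, fderiv ℝ (fun y => fderiv ℝ F (y, c) (0, w)) c v =
      VectorField.lieBracket ℝ (fun y => fderiv ℝ μ (y, c) (0, v))
        (fun y => fderiv ℝ μ (y, c) (0, w)) c := by
  have hl : HasFDerivAt (fun y : E => (y, c)) (ContinuousLinearMap.inl ℝ E E) c :=
    hasFDerivAt_prodMk_left c c
  have hr : HasFDerivAt (fun y : E => (c, y)) (ContinuousLinearMap.inr ℝ E E) c :=
    hasFDerivAt_prodMk_right c c
  have hcl : Filter.Tendsto (fun y : E => (y, c)) (𝓝 c) (𝓝 (c, c)) := hl.continuousAt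
  have hcr : Filter.Tendsto (fun y : E => (c, y)) (𝓝 c) (𝓝 (c, c)) := hr.continuousAt
  set M := fderiv ℝ (fderiv ℝ μ) (c, c) with hM
  have hMd : HasFDerivAt (fderiv ℝ μ) M (c, c) :=
    ((hμ.fderiv_right (m := 1) (by norm_num)).differentiableAt (by norm_num)).hasFDerivAt
  have hNd : DifferentiableAt ℝ (fderiv ℝ F) (c, c) :=
    (hF.fderiv_right (m := 1) (by norm_num)).differentiableAt (by norm_num)
  have hsymm : ∀ a b, M a b = M b a :=
    fun a b => (hμ.isSymmSndFDerivAt (by simp)).eq a b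
  have hV : ∀ w : E, HasFDerivAt (fun y => fderiv ℝ μ (y, c) (0, w))
      ((ContinuousLinearMap.apply ℝ E ((0, w) : E × E)).comp
        (M.comp (ContinuousLinearMap.inl ℝ E E))) c := fun w =>
    (ContinuousLinearMap.apply ℝ E ((0, w) : E × E)).hasFDerivAt.comp c
      (HasFDerivAt.comp (f := fun y : E => (y, c)) c hMd hl)
  have hα : DifferentiableAt ℝ (fun y => fderiv ℝ F (y, c) (0, w)) c :=
    (ContinuousLinearMap.apply ℝ E ((0, w) : E × E)).differentiableAt.comp c
      (DifferentiableAt.comp (f := fun y : E => (y, c)) c hNd hl.differentiableAt)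
  have hμd : DifferentiableAt ℝ μ (c, c) := hμ.differentiableAt (by norm_num)
  have hFd : DifferentiableAt ℝ F (c, c) := hF.differentiableAt (by norm_num)
  have hDμl : ∀ z, fderiv ℝ μ (c, c) (z, 0) = z := by
    intro z
    have h1 := HasFDerivAt.comp (f := fun y : E => (y, c)) c hμd.hasFDerivAt hl
    have h2 : HasFDerivAt (μ ∘ fun y : E => (y, c)) (ContinuousLinearMap.id ℝ E) c :=
      (hasFDerivAt_id c).congr_of_eventuallyEq hμ1
    exact DFunLike.congr_fun (h1.unique h2) z
  have hDμr : ∀ z, fderiv ℝ μ (c, c) (0, z) = z := by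
    intro z
    have h1 := HasFDerivAt.comp (f := fun y : E => (c, y)) c hμd.hasFDerivAt hr
    have h2 : HasFDerivAt (μ ∘ fun y : E => (c, y)) (ContinuousLinearMap.id ℝ E) c :=
      (hasFDerivAt_id c).congr_of_eventuallyEq hμ2
    exact DFunLike.congr_fun (h1.unique h2) z
  have hDFr : ∀ z, fderiv ℝ F (c, c) (0, z) = z := by
    intro z
    have h1 := HasFDerivAt.comp (f := fun y : E => (c, y)) c hFd.hasFDerivAt hr
    have h2 : HasFDerivAt (F ∘ fun y : E => (c, y)) (ContinuousLinearMap.id ℝ E) c :=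
      (hasFDerivAt_id c).congr_of_eventuallyEq hF2
    exact DFunLike.congr_fun (h1.unique h2) z
  refine ⟨hα, fun v => ?_⟩
  -- Differentiate `μ (F (y, x), y) = μ (y, x)`, that is `(y x y⁻¹) y = y x`, with respect to `x` at
  -- the unit. Differentiating the result in `y` gives `h5`.
  have hid : ∀ᶠ y in 𝓝 c, fderiv ℝ μ (c, y) (fderiv ℝ F (y, c) (0, w), 0) =
      fderiv ℝ μ (y, c) (0, w) := by
    have hμe : ∀ᶠ p in 𝓝 (c, c), DifferentiableAt ℝ μ p :=
      (hμ.eventually (by simp)).mono fun p hp => hp.differentiableAt (by norm_num)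
    have hFe : ∀ᶠ p in 𝓝 (c, c), DifferentiableAt ℝ F p :=
      (hF.eventually (by simp)).mono fun p hp => hp.differentiableAt (by norm_num)
    filter_upwards [hcl.eventually hFe, hcr.eventually hμe, hF1,
      hcl.eventually hμF.eventually_nhds] with y hFy hμy hF1y hμFy
    have h1 : HasFDerivAt (fun p : E × E => (F p, p.1))
        ((fderiv ℝ F (y, c)).prod (ContinuousLinearMap.fst ℝ E E)) (y, c) :=
      hFy.hasFDerivAt.prodMk hasFDerivAt_fst
    have h2 : HasFDerivAt μ (fderiv ℝ μ (c, y)) (F (y, c), y) := by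
      rw [hF1y]; exact hμy.hasFDerivAt
    have h3 := HasFDerivAt.comp (f := fun p : E × E => (F p, p.1)) (y, c) h2 h1
    have h4 : HasFDerivAt μ _ (y, c) := h3.congr_of_eventuallyEq (hμFy.mono fun p hp => hp.symm)
    rw [h4.fderiv]
    rfl
  have hg : HasFDerivAt (fun y => fderiv ℝ μ (c, y) (fderiv ℝ F (y, c) (0, w), 0)) _ c :=
    (HasFDerivAt.comp (f := fun y : E => (c, y)) c hMd hr).clm_apply
      (hα.hasFDerivAt.prodMk (hasFDerivAt_const (0 : E) c))
  have huniq := (hg.congr_of_eventuallyEq (hid.mono fun y hy => hy.symm)).unique (hV w)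
  have h5 := DFunLike.congr_fun huniq v
  simp only [add_apply, ContinuousLinearMap.comp_apply, ContinuousLinearMap.flip_apply,
    ContinuousLinearMap.prod_apply, ContinuousLinearMap.inl_apply, ContinuousLinearMap.inr_apply,
    ContinuousLinearMap.apply_apply, zero_apply, hDFr] at h5
  rw [VectorField.lieBracket, (hV w).fderiv, (hV v).fderiv]
  simp only [ContinuousLinearMap.comp_apply, ContinuousLinearMap.inl_apply,
    ContinuousLinearMap.apply_apply, hDμr]
  -- Symmetry of the second derivative identifies the extra term of `h5` with the subtracted half of
  -- the Lie bracket.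
  rw [← h5, hsymm (w, 0) (0, v), add_sub_cancel_right]
  exact (hDμl _).symm

end Calculus

/-- By linearity `tr p(T) = p(1) N` for every polynomial `p`, and `(X - 1) ^ k` vanishes at 1 for `k
≥ 1`. -/
theorem LinearMap.isNilpotent_sub_one_of_forall_trace_pow_eq {K V : Type*} [Field K] [CharZero K]
    [AddCommGroup V] [Module K V] [FiniteDimensional K V] (T : Module.End K V) (N : K)
    (h : ∀ k, LinearMap.trace K V (T ^ k) = N) : IsNilpotent (T - 1) := by
  have key : ∀ p : Polynomial K, LinearMap.trace K V (Polynomial.aeval T p) = p.eval 1 * N := by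
    intro p
    induction p using Polynomial.induction_on' with
    | add p q hp hq => rw [map_add, map_add, hp, hq, Polynomial.eval_add, add_mul]
    | monomial n c =>
      rw [Polynomial.aeval_monomial, Algebra.algebraMap_eq_smul_one, smul_one_mul, map_smul, h,
        Polynomial.eval_monomial, one_pow, mul_one, smul_eq_mul]
  refine LinearMap.isNilpotent_of_forall_trace_pow_eq_zero _ fun k hk => ?_
  have h1 := key ((Polynomial.X - 1) ^ k)
  rw [map_pow, map_sub, Polynomial.aeval_X, map_one] at h1
  rw [h1, Polynomial.eval_pow, Polynomial.eval_sub, Polynomial.eval_X, Polynomial.eval_one,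
    sub_self, zero_pow (by omega), zero_mul]

/-- A function on a manifold with vanishing derivative is locally constant. -/
theorem isLocallyConstant_of_hasMFDerivAt_zero {d : ℕ} {N : Type*} [TopologicalSpace N]
    [ChartedSpace (EuclideanSpace ℝ (Fin d)) N] [IsManifold (𝓡 d) 1 N] {f : N → ℝ}
    (hf : ∀ x, HasMFDerivAt (𝓡 d) 𝓘(ℝ, ℝ) f x (0 : EuclideanSpace ℝ (Fin d) →L[ℝ] ℝ)) :
    IsLocallyConstant f := by
  rw [IsLocallyConstant.iff_eventually_eq]
  intro x
  set e := extChartAt (𝓡 d) x with he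
  obtain ⟨r, hr, hball⟩ := Metric.mem_nhds_iff.1
    ((isOpen_extChartAt_target (I := 𝓡 d) x).mem_nhds (mem_extChartAt_target (I := 𝓡 d) x))
  have hderiv : ∀ y ∈ Metric.ball (e x) r, HasFDerivAt (f ∘ e.symm)
      (0 : EuclideanSpace ℝ (Fin d) →L[ℝ] ℝ) y := by
    intro y hy
    have h1 : MDifferentiableAt 𝓘(ℝ, EuclideanSpace ℝ (Fin d)) (𝓡 d) e.symm y :=
      ((contMDiffOn_extChartAt_symm (I := 𝓡 d) (n := 1) x).mdifferentiableOn
        (by simp)).mdifferentiableAt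
        ((isOpen_extChartAt_target (I := 𝓡 d) x).mem_nhds (hball hy))
    have h2 := HasMFDerivAt.comp y (hf (e.symm y)) h1.hasMFDerivAt
    have h3 : HasFDerivAt (f ∘ e.symm) ((0 : EuclideanSpace ℝ (Fin d) →L[ℝ] ℝ).comp
      (mfderiv 𝓘(ℝ, EuclideanSpace ℝ (Fin d)) (𝓡 d) e.symm y :
        EuclideanSpace ℝ (Fin d) →L[ℝ] EuclideanSpace ℝ (Fin d))) y := h2.hasFDerivAt
    exact h3.congr_fderiv (ContinuousLinearMap.zero_comp _)
  filter_upwards [extChartAt_source_mem_nhds (I := 𝓡 d) x,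
    (continuousAt_extChartAt (I := 𝓡 d) x).preimage_mem_nhds (Metric.ball_mem_nhds _ hr)]
    with y hy hyb
  have h4 := Metric.isOpen_ball.is_const_of_fderiv_eq_zero (𝕜 := ℝ)
    (convex_ball (e x) r).isPreconnected
    (fun z hz => (hderiv z hz).differentiableAt.differentiableWithinAt)
    (fun z hz => (hderiv z hz).fderiv) hyb (Metric.mem_ball_self hr)
  simp only [Function.comp_apply] at h4
  rwa [e.left_inv hy, e.left_inv (mem_extChartAt_source (I := 𝓡 d) x)] at h4

/-! ### The adjoint representation and its differential -/

noncomputable section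

namespace RankOne

variable {m : ℕ} {G : Type*} [Group G] [TopologicalSpace G]
  [ChartedSpace (EuclideanSpace ℝ (Fin m)) G]

local notation "𝔼" => EuclideanSpace ℝ (Fin m)

local notation "chartOne" => extChartAt (𝓡 m) (1 : G)

local notation "chartInv" => PartialEquiv.symm (extChartAt (𝓡 m) (1 : G))

variable (m G) in
/-- The group law read in the chart at the identity. -/
def localMul (p : 𝔼 × 𝔼) : 𝔼 := chartOne (chartInv p.1 * chartInv p.2)

variable (m G) in
/-- Conjugation read in the chart at the identity. -/
def localConj (p : 𝔼 × 𝔼) : 𝔼 := chartOne (chartInv p.1 * chartInv p.2 * (chartInv p.1)⁻¹)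

theorem chart_symm_chart_one : chartInv (chartOne (1 : G)) = (1 : G) := extChartAt_to_inv (1 : G)

theorem eventually_chart_target :
    ∀ᶠ y in 𝓝 (chartOne (1 : G)), y ∈ (chartOne : PartialEquiv G 𝔼).target :=
  extChartAt_target_mem_nhds (1 : G)

theorem localMul_one : ∀ᶠ y in 𝓝 (chartOne (1 : G)), localMul m G (y, chartOne (1 : G)) = y := by
  filter_upwards [eventually_chart_target (m := m) (G := G)] with y hy
  simp only [localMul, chart_symm_chart_one, mul_one]
  exact (chartOne : PartialEquiv G 𝔼).right_inv hy

theorem one_localMul : ∀ᶠ y in 𝓝 (chartOne (1 : G)), localMul m G (chartOne (1 : G), y) = y := by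
  filter_upwards [eventually_chart_target (m := m) (G := G)] with y hy
  simp only [localMul, chart_symm_chart_one, one_mul]
  exact (chartOne : PartialEquiv G 𝔼).right_inv hy

theorem localConj_one : ∀ᶠ y in 𝓝 (chartOne (1 : G)),
    localConj m G (y, chartOne (1 : G)) = chartOne (1 : G) :=
  Filter.Eventually.of_forall fun y => by
    simp only [localConj, chart_symm_chart_one, mul_one, mul_inv_cancel]

theorem one_localConj : ∀ᶠ y in 𝓝 (chartOne (1 : G)), localConj m G (chartOne (1 : G), y) = y := by
  filter_upwards [eventually_chart_target (m := m) (G := G)] with y hy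
  simp only [localConj, chart_symm_chart_one, one_mul, inv_one, mul_one]
  exact (chartOne : PartialEquiv G 𝔼).right_inv hy

theorem tendsto_prodMk_chartOne :
    Filter.Tendsto (fun y : 𝔼 => (y, chartOne (1 : G))) (𝓝 (chartOne (1 : G)))
      (𝓝 (chartOne (1 : G), chartOne (1 : G))) :=
  (hasFDerivAt_prodMk_left (𝕜 := ℝ) (chartOne (1 : G)) (chartOne (1 : G))).continuousAt

theorem fderiv_prodMk_left_apply {f : 𝔼 × 𝔼 → 𝔼} {y c : 𝔼} (hf : DifferentiableAt ℝ f (y, c))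
    (w : 𝔼) : fderiv ℝ (fun x => f (y, x)) c w = fderiv ℝ f (y, c) (0, w) := by
  have h := HasFDerivAt.comp (f := fun x : 𝔼 => (y, x)) c hf.hasFDerivAt
    (hasFDerivAt_prodMk_right y c)
  exact DFunLike.congr_fun h.fderiv w

variable [LieGroup (𝓡 m) ∞ G]

theorem isManifold_infty : IsManifold (𝓡 m) ∞ G :=
  (inferInstance : LieGroup (𝓡 m) ∞ G).toIsManifold

theorem contMDiffAt_chart_symm :
    ContMDiffAt 𝓘(ℝ, 𝔼) (𝓡 m) ∞ (chartInv : 𝔼 → G) (chartOne (1 : G)) := by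
  have := isManifold_infty (m := m) (G := G)
  exact (contMDiffOn_extChartAt_symm (1 : G)).contMDiffAt (extChartAt_target_mem_nhds (1 : G))

theorem contMDiffAt_chart : ContMDiffAt (𝓡 m) 𝓘(ℝ, 𝔼) ∞ chartOne (1 : G) := by
  have := isManifold_infty (m := m) (G := G)
  exact contMDiffAt_extChartAt

theorem contMDiffAt_chart_symm_fst :
    ContMDiffAt 𝓘(ℝ, 𝔼 × 𝔼) (𝓡 m) ∞ (fun p : 𝔼 × 𝔼 => (chartInv p.1 : G))
      (chartOne (1 : G), chartOne (1 : G)) :=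
  ContMDiffAt.comp (g := (chartInv : 𝔼 → G)) (f := Prod.fst) (chartOne (1 : G), chartOne (1 : G))
    contMDiffAt_chart_symm contDiff_fst.contMDiff.contMDiffAt

theorem contMDiffAt_chart_symm_snd :
    ContMDiffAt 𝓘(ℝ, 𝔼 × 𝔼) (𝓡 m) ∞ (fun p : 𝔼 × 𝔼 => (chartInv p.2 : G))
      (chartOne (1 : G), chartOne (1 : G)) :=
  ContMDiffAt.comp (g := (chartInv : 𝔼 → G)) (f := Prod.snd) (chartOne (1 : G), chartOne (1 : G))
    contMDiffAt_chart_symm contDiff_snd.contMDiff.contMDiffAt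

theorem contMDiffAt_localMul_aux :
    ContMDiffAt 𝓘(ℝ, 𝔼 × 𝔼) (𝓡 m) ∞ (fun p : 𝔼 × 𝔼 => (chartInv p.1 * chartInv p.2 : G))
      (chartOne (1 : G), chartOne (1 : G)) :=
  contMDiffAt_chart_symm_fst.mul contMDiffAt_chart_symm_snd

theorem contMDiffAt_localConj_aux :
    ContMDiffAt 𝓘(ℝ, 𝔼 × 𝔼) (𝓡 m) ∞
      (fun p : 𝔼 × 𝔼 => (chartInv p.1 * chartInv p.2 * (chartInv p.1)⁻¹ : G))
      (chartOne (1 : G), chartOne (1 : G)) :=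
  contMDiffAt_localMul_aux.mul contMDiffAt_chart_symm_fst.inv

theorem contDiffAt_localMul :
    ContDiffAt ℝ 2 (localMul m G) (chartOne (1 : G), chartOne (1 : G)) := by
  have h : ContMDiffAt 𝓘(ℝ, 𝔼 × 𝔼) 𝓘(ℝ, 𝔼) ∞ (localMul m G) (chartOne (1 : G), chartOne (1 : G)) :=
    ContMDiffAt.comp_of_eq (g := chartOne) contMDiffAt_chart contMDiffAt_localMul_aux
      (by simp only [chart_symm_chart_one, mul_one])
  exact (contMDiffAt_iff_contDiffAt.1 h).of_le (ENat.LEInfty.out)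

theorem contDiffAt_localConj :
    ContDiffAt ℝ 2 (localConj m G) (chartOne (1 : G), chartOne (1 : G)) := by
  have h : ContMDiffAt 𝓘(ℝ, 𝔼 × 𝔼) 𝓘(ℝ, 𝔼) ∞ (localConj m G) (chartOne (1 : G), chartOne (1 : G)) :=
    ContMDiffAt.comp_of_eq (g := chartOne) contMDiffAt_chart contMDiffAt_localConj_aux
      (by simp only [chart_symm_chart_one, mul_one, inv_one])
  exact (contMDiffAt_iff_contDiffAt.1 h).of_le (ENat.LEInfty.out)

theorem localMul_localConj : ∀ᶠ p in 𝓝 (chartOne (1 : G), chartOne (1 : G)),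
    localMul m G (localConj m G p, p.1) = localMul m G p := by
  have h1 := (contMDiffAt_localConj_aux (m := m) (G := G)).continuousAt
  have h2 : (chartOne : PartialEquiv G 𝔼).source ∈
      𝓝 ((chartInv (chartOne (1 : G)) * chartInv (chartOne (1 : G)) *
        (chartInv (chartOne (1 : G)))⁻¹ : G)) := by
    simp only [chart_symm_chart_one, mul_one, inv_one]
    exact extChartAt_source_mem_nhds (1 : G)
  filter_upwards [h1.eventually h2] with p hp
  rw [localMul, localMul, localConj]
  dsimp only
  rw [(chartOne : PartialEquiv G 𝔼).left_inv hp, inv_mul_cancel_right]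

/-- The derivative of the conjugation in the chart. -/
theorem Ad_eq_fderiv (g : G) :
    (Ad m g : 𝔼 →L[ℝ] 𝔼) =
      fderiv ℝ (fun x : 𝔼 => chartOne (g * chartInv x * g⁻¹)) (chartOne (1 : G)) := by
  have h := mdifferentiableAt_conj (m := m) g
  have h1 : (Ad m g : 𝔼 →L[ℝ] 𝔼) = fderivWithin ℝ
      (writtenInExtChartAt (𝓡 m) (𝓡 m) (1 : G) (fun x : G => g * x * g⁻¹)) (Set.range (𝓡 m))
      (chartOne (1 : G)) := h.mfderiv
  have h2 : writtenInExtChartAt (𝓡 m) (𝓡 m) (1 : G) (fun x : G => g * x * g⁻¹) =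
      fun x : 𝔼 => chartOne (g * chartInv x * g⁻¹) := by
    have h3 : g * 1 * g⁻¹ = (1 : G) := by simp
    funext x
    change extChartAt (𝓡 m) (g * 1 * g⁻¹) (g * chartInv x * g⁻¹) = _
    rw [h3]
  rw [h1, h2, (𝓡 m).range_eq_univ, fderivWithin_univ]

/-- A left invariant vector field in the chart. -/
theorem mfderiv_chart_mulInvariantVectorField (g : G)
    (hg : g ∈ (chartOne : PartialEquiv G 𝔼).source)
    (w : LieAlg m G) :
    (mfderiv (𝓡 m) 𝓘(ℝ, 𝔼) chartOne g (mulInvariantVectorField w g) : 𝔼) =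
      fderiv ℝ (fun x : 𝔼 => chartOne (g * chartInv x)) (chartOne (1 : G)) w := by
  have := isManifold_infty (m := m) (G := G)
  have hL : MDifferentiableAt (𝓡 m) (𝓡 m) (fun x : G => g * x) 1 :=
    (contMDiff_mul_left (I := 𝓡 m) (n := ∞) (a := g)).mdifferentiable (by simp) 1
  have hch : ∀ z, z = g → MDifferentiableAt (𝓡 m) 𝓘(ℝ, 𝔼) chartOne z := by
    rintro z rfl
    exact mdifferentiableAt_extChartAt (by rwa [extChartAt_source] at hg)
  have hch1 := hch (g * 1) (mul_one g)
  have key := mfderiv_comp (I := 𝓡 m) (I' := 𝓡 m) (I'' := 𝓘(ℝ, 𝔼)) (1 : G) hch1 hL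
  have hcast : ∀ z : G, z = g →
      (mfderiv (𝓡 m) 𝓘(ℝ, 𝔼) chartOne z : 𝔼 →L[ℝ] 𝔼) = mfderiv (𝓡 m) 𝓘(ℝ, 𝔼) chartOne g := by
    rintro z rfl; rfl
  have h1 : (mfderiv (𝓡 m) 𝓘(ℝ, 𝔼) chartOne g (mulInvariantVectorField w g) : 𝔼) =
      (mfderiv (𝓡 m) 𝓘(ℝ, 𝔼) (chartOne ∘ fun x : G => g * x) 1 : 𝔼 →L[ℝ] 𝔼) w := by
    rw [key]
    exact (DFunLike.congr_fun (hcast (g * 1) (mul_one g)) _).symm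
  rw [h1, (MDifferentiableAt.comp (1 : G) hch1 hL).mfderiv, (𝓡 m).range_eq_univ,
    fderivWithin_univ]
  rfl

theorem pullback_mulInvariantVectorField (w : 𝔼) :
    (VectorField.mpullbackWithin 𝓘(ℝ, 𝔼) (𝓡 m) chartInv
        (mulInvariantVectorField (show LieAlg m G from w))
        (Set.range (𝓡 m)) : 𝔼 → 𝔼) =ᶠ[𝓝 (chartOne (1 : G))]
      fun y => fderiv ℝ (localMul m G) (y, chartOne (1 : G)) (0, w) := by
  have := isManifold_infty (m := m) (G := G)
  have hd : ∀ᶠ p in 𝓝 (chartOne (1 : G), chartOne (1 : G)),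
      DifferentiableAt ℝ (localMul m G) p :=
    ((contDiffAt_localMul (m := m) (G := G)).eventually (by simp)).mono
      fun p hp => hp.differentiableAt (by norm_num)
  filter_upwards [eventually_chart_target (m := m) (G := G),
    tendsto_prodMk_chartOne.eventually hd] with y hy hdy
  have hsrc : chartInv y ∈ (chartOne : PartialEquiv G 𝔼).source :=
    (chartOne : PartialEquiv G 𝔼).map_target hy
  have h1 := mfderiv_chart_mulInvariantVectorField (chartInv y) hsrc w
  refine Eq.trans ?_ (h1.trans (fderiv_prodMk_left_apply hdy w))
  have hinv := isInvertible_mfderivWithin_extChartAt_symm (I := 𝓡 m) (x := (1 : G)) hy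
  refine hinv.inverse_apply_eq.2 ?_
  exact (DFunLike.congr_fun (mfderivWithin_extChartAt_symm_comp_mfderiv_extChartAt (I := 𝓡 m)
    (x := (1 : G)) hy) _).symm

/-- The bracket on `T₁G` is that of left invariant fields pulled back through the chart at 1, whose
derivative at 1 is the identity, so no correction factor appears. -/
theorem lie_eq_lieBracket (v w : LieAlg m G) :
    (⁅v, w⁆ : LieAlg m G) = (VectorField.lieBracket ℝ
      (fun y => fderiv ℝ (localMul m G) (y, chartOne (1 : G)) (0, v))
      (fun y => fderiv ℝ (localMul m G) (y, chartOne (1 : G)) (0, w)) (chartOne (1 : G)) : 𝔼) := by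
  have := isManifold_infty (m := m) (G := G)
  have hid : ∀ (A : 𝔼 →L[ℝ] 𝔼), A = ContinuousLinearMap.id ℝ 𝔼 → ∀ z, A.inverse z = z := by
    rintro A rfl z
    rw [ContinuousLinearMap.inverse_id, ContinuousLinearMap.id_apply]
  have hset : (chartInv : 𝔼 → G) ⁻¹' Set.univ ∩ Set.range (𝓡 m) = Set.univ := by
    rw [(𝓡 m).range_eq_univ, Set.preimage_univ, Set.univ_inter]
  refine (hid _ (mfderiv_extChartAt_self (I := 𝓡 m) (x := (1 : G))) _).trans ?_
  rw [hset]
  refine (congrFun VectorField.lieBracketWithin_univ _).trans ?_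
  exact (pullback_mulInvariantVectorField v).lieBracket_vectorField_eq
    (pullback_mulInvariantVectorField w)

variable (m) in
/-- The orbit map `g ↦ Ad g w`, with values in the model space. -/
def adOrbit (w : 𝔼) (g : G) : 𝔼 := Ad m g (show LieAlg m G from w)

/-- The derivative of the adjoint action at the identity is the Lie bracket. -/
theorem exists_hasMFDerivAt_adOrbit (w : 𝔼) :
    ∃ D : 𝔼 →L[ℝ] 𝔼, (∀ v : 𝔼, D v = ⁅(show LieAlg m G from v), (show LieAlg m G from w)⁆) ∧
      HasMFDerivAt (𝓡 m) 𝓘(ℝ, 𝔼) (adOrbit (G := G) m w) 1 D := by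
  have := isManifold_infty (m := m) (G := G)
  obtain ⟨hd, hbr⟩ := fderiv_conj_eq_lieBracket (contDiffAt_localMul (m := m) (G := G))
    contDiffAt_localConj localMul_one one_localMul localConj_one one_localConj
    localMul_localConj w
  have hF : ∀ᶠ p in 𝓝 (chartOne (1 : G), chartOne (1 : G)),
      DifferentiableAt ℝ (localConj m G) p :=
    ((contDiffAt_localConj (m := m) (G := G)).eventually (by simp)).mono
      fun p hp => hp.differentiableAt (by norm_num)
  have heq : ∀ᶠ y in 𝓝 (chartOne (1 : G)), adOrbit m w (chartInv y) =
      fderiv ℝ (localConj m G) (y, chartOne (1 : G)) (0, w) := by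
    filter_upwards [tendsto_prodMk_chartOne.eventually hF] with y hy
    exact (DFunLike.congr_fun (Ad_eq_fderiv (m := m) (chartInv y)) w).trans
      (fderiv_prodMk_left_apply hy w)
  set D := fderiv ℝ (fun y => fderiv ℝ (localConj m G) (y, chartOne (1 : G)) (0, w))
    (chartOne (1 : G)) with hD
  have hder : HasFDerivAt (fun y : 𝔼 => adOrbit m w (chartInv y)) D (chartOne (1 : G)) :=
    hd.hasFDerivAt.congr_of_eventuallyEq heq
  refine ⟨D, fun v => (hbr v).trans (lie_eq_lieBracket (m := m) (G := G) v w).symm, ?_, ?_⟩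
  · have h1 : ContinuousAt ((fun y : 𝔼 => adOrbit m w (chartInv y)) ∘ chartOne) (1 : G) :=
      ContinuousAt.comp hder.continuousAt (continuousAt_extChartAt (1 : G))
    refine h1.congr ?_
    filter_upwards [extChartAt_source_mem_nhds (I := 𝓡 m) (1 : G)] with g hg
    simp only [Function.comp_apply]
    rw [(chartOne : PartialEquiv G 𝔼).left_inv hg]
  · exact hder.hasFDerivWithinAt

instance finiteDimensional_lieAlg : FiniteDimensional ℝ (LieAlg m G) :=
  (inferInstance : FiniteDimensional ℝ 𝔼)

theorem adOrbit_mul (g h : G) (w : 𝔼) :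
    adOrbit m w (g * h) = (Ad m g : 𝔼 →L[ℝ] 𝔼) (adOrbit m w h) := by
  unfold adOrbit
  rw [Ad_mul]
  rfl

theorem hasMFDerivAt_comp_of_eq_one {d : ℕ} {N : Type*} [TopologicalSpace N]
    [ChartedSpace (EuclideanSpace ℝ (Fin d)) N] {f : N → G} {x : N} (hx : f x = 1)
    {A : EuclideanSpace ℝ (Fin d) →L[ℝ] 𝔼} (hf : HasMFDerivAt (𝓡 d) (𝓡 m) f x A) (w : 𝔼) :
    ∃ D : EuclideanSpace ℝ (Fin d) →L[ℝ] 𝔼,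
      (∀ u, D u = ⁅(show LieAlg m G from A u), (show LieAlg m G from w)⁆) ∧
      HasMFDerivAt (𝓡 d) 𝓘(ℝ, 𝔼) (fun y => adOrbit m w (f y)) x D := by
  obtain ⟨D, hD, hd⟩ := exists_hasMFDerivAt_adOrbit (G := G) w
  refine ⟨D.comp A, fun u => hD (A u), ?_⟩
  -- Tangent spaces depend on the base point and `f x` equals 1 only propositionally, so the
  -- derivative is transported by substitution.
  have h1 : ∀ z : G, z = 1 → HasMFDerivAt (𝓡 m) 𝓘(ℝ, 𝔼) (adOrbit (G := G) m w) z D := by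
    rintro z rfl; exact hd
  exact HasMFDerivAt.comp x (h1 _ hx) hf

/-- The derivative of the adjoint action along a one-parameter subgroup. -/
theorem IsOneParameterSubgroup.hasDerivAt_adOrbit {φ : ℝ → G} {v : LieAlg m G}
    (h : IsOneParameterSubgroup φ v) (w : 𝔼) :
    HasDerivAt (fun t => adOrbit m w (φ t)) (⁅v, (show LieAlg m G from w)⁆ : LieAlg m G) 0 := by
  have h0 : φ 0 = 1 := by
    have := h.map_add 0 0
    rw [add_zero] at this
    exact left_eq_mul.1 this
  obtain ⟨D, hD, hd⟩ := exists_hasMFDerivAt_adOrbit (G := G) w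
  have h1 : ∀ z : G, z = 1 → HasMFDerivAt (𝓡 m) 𝓘(ℝ, 𝔼) (adOrbit (G := G) m w) z D := by
    rintro z rfl; exact hd
  have h2 : HasMFDerivAt 𝓘(ℝ, ℝ) (𝓡 m) φ 0 (mfderiv 𝓘(ℝ, ℝ) (𝓡 m) φ 0) :=
    (h.contMDiff.mdifferentiable (by simp) 0).hasMFDerivAt
  have h3 : HasMFDerivAt 𝓘(ℝ, ℝ) 𝓘(ℝ, 𝔼) (adOrbit (G := G) m w ∘ φ) 0 _ :=
    HasMFDerivAt.comp 0 (h1 _ h0) h2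
  have h4 : HasFDerivAt (fun t => adOrbit m w (φ t))
      (D.comp (mfderiv 𝓘(ℝ, ℝ) (𝓡 m) φ 0 : ℝ →L[ℝ] 𝔼)) 0 := h3.hasFDerivAt
  refine h4.hasDerivAt.congr_deriv ?_
  refine (hD _).trans ?_
  have h5 := h.velocity
  exact congrArg (fun z : LieAlg m G => ⁅z, (show LieAlg m G from w)⁆) h5

/-- The Lie algebra of the maximal compact subgroup is fixed by `θ`. -/
theorem theta_eq_self_of_mem_closedSubgroupLieAlg (θ : LieAlg m G ≃ₗ⁅ℝ⁆ LieAlg m G)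
    (hθ : IsCartanInvolution θ) {v : LieAlg m G}
    (hv : v ∈ closedSubgroupLieAlg m (maxCompact θ)) : θ v = v := by
  have hle : closedSubgroupLieAlg m (maxCompact θ) ≤
      LinearMap.ker ((θ : LieAlg m G →ₗ[ℝ] LieAlg m G) - LinearMap.id) := by
    refine Submodule.span_le.2 ?_
    rintro v ⟨φ, hφ, hK⟩
    refine eq_zero_of_forall_lie_eq_zero θ hθ.pos (x := θ v - v) fun y => ?_
    let T₀ : LieAlg m G →ₗ[ℝ] LieAlg m G := θ
    let T : 𝔼 →L[ℝ] 𝔼 := LinearMap.toContinuousLinearMap (show 𝔼 →ₗ[ℝ] 𝔼 from T₀)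
    -- Differentiating `Ad (φ t) ∘ θ = θ ∘ Ad (φ t)` at 0 gives `[v, θ y'] = [θ v, θ y']`; with `y'
    -- = θ⁻¹ y`, the element `θ v - v` is central.
    have h1 := hφ.hasDerivAt_adOrbit (θ (θ.symm y))
    have h2 := T.hasFDerivAt.comp_hasDerivAt (0 : ℝ) (hφ.hasDerivAt_adOrbit (θ.symm y))
    have h3 : (fun t => adOrbit m (θ (θ.symm y)) (φ t)) =
        T ∘ fun t => adOrbit m (θ.symm y) (φ t) := by
      funext t
      exact hK t (θ.symm y)
    rw [h3] at h1
    have h4 := h2.unique h1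
    have h5 : θ ⁅v, θ.symm y⁆ = ⁅v, θ (θ.symm y)⁆ := h4
    rw [LieEquiv.map_lie, LieEquiv.apply_symm_apply] at h5
    rw [sub_lie, ← h5, sub_self]
  exact sub_eq_zero.1 (hle hv)

theorem mem_cartanP {θ : LieAlg m G ≃ₗ⁅ℝ⁆ LieAlg m G} {x : LieAlg m G} :
    x ∈ cartanP θ ↔ θ x = -x := Iff.rfl

/-- The Lie algebra of K is θ-fixed, so it meets 𝔭 only in 0 and 𝔭 injects into the quotient. Only
this inequality is needed. -/
theorem finrank_cartanP_le (θ : LieAlg m G ≃ₗ⁅ℝ⁆ LieAlg m G) (hθ : IsCartanInvolution θ) :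
    Module.finrank ℝ (cartanP θ) ≤ symmetricSpaceDim θ := by
  refine LinearMap.finrank_le_finrank_of_injective
    (f := (closedSubgroupLieAlg m (maxCompact θ)).mkQ ∘ₗ (cartanP θ).subtype) ?_
  rw [injective_iff_map_eq_zero]
  intro x hx
  have h1 : (x : LieAlg m G) ∈ closedSubgroupLieAlg m (maxCompact θ) :=
    (Submodule.Quotient.mk_eq_zero _).1 hx
  have h2 := theta_eq_self_of_mem_closedSubgroupLieAlg θ hθ h1
  have h3 : (2 : ℝ) • (x : LieAlg m G) = 0 := by
    rw [two_smul]
    exact eq_neg_iff_add_eq_zero.1 (h2.symm.trans x.2)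
  exact Subtype.ext ((smul_eq_zero.1 h3).resolve_left two_ne_zero)

/-! ### Consequences of real rank one -/

section RealRank

variable {θ : LieAlg m G ≃ₗ⁅ℝ⁆ LieAlg m G}

theorem bddAbove_abelian_dims : BddAbove {r : ℕ | ∃ A : Submodule ℝ (LieAlg m G), A ≤ cartanP θ ∧
    (∀ x ∈ A, ∀ y ∈ A, ⁅x, y⁆ = 0) ∧ Module.finrank ℝ A = r} := by
  refine ⟨Module.finrank ℝ (LieAlg m G), ?_⟩
  rintro _ ⟨A, -, -, rfl⟩
  exact Submodule.finrank_le A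

theorem exists_ne_zero_of_realRank (h : realRank θ = 1) : ∃ p, p ≠ 0 ∧ θ p = -p := by
  have h1 := Nat.sSup_mem (s := {r : ℕ | ∃ A : Submodule ℝ (LieAlg m G), A ≤ cartanP θ ∧
    (∀ x ∈ A, ∀ y ∈ A, ⁅x, y⁆ = 0) ∧ Module.finrank ℝ A = r})
    ⟨0, ⊥, bot_le, by
      intro x hx y _
      rw [(Submodule.mem_bot ℝ).1 hx, zero_lie], finrank_bot ℝ _⟩ bddAbove_abelian_dims
  obtain ⟨A, hA, -, hr⟩ := h1
  have hne : A ≠ ⊥ := by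
    rintro rfl
    rw [finrank_bot] at hr
    rw [realRank, ← hr] at h
    exact zero_ne_one h
  obtain ⟨p, hp, hp0⟩ := Submodule.exists_mem_ne_zero_of_ne_bot hne
  exact ⟨p, hp0, hA hp⟩

theorem exists_eq_smul_of_realRank (h : realRank θ = 1) (x y : LieAlg m G) (hx : θ x = -x)
    (hy : θ y = -y) (hxy : ⁅x, y⁆ = 0) (hx0 : x ≠ 0) : ∃ c : ℝ, y = c • x := by
  by_contra hcon
  push Not at hcon
  have hli : LinearIndependent ℝ ![x, y] := by
    rw [LinearIndependent.pair_iff' hx0]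
    exact fun c hc => hcon c hc.symm
  have hdim : Module.finrank ℝ (Submodule.span ℝ (Set.range ![x, y])) = 2 := by
    rw [finrank_span_eq_card hli, Fintype.card_fin]
  have hle : (2 : ℕ) ≤ realRank θ := by
    refine le_csSup bddAbove_abelian_dims ⟨Submodule.span ℝ (Set.range ![x, y]), ?_, ?_, hdim⟩
    · rw [Submodule.span_le]
      rintro _ ⟨i, rfl⟩
      fin_cases i
      · exact hx
      · exact hy
    · rw [Matrix.range_cons, Matrix.range_cons, Matrix.range_empty, Set.union_empty,
        Set.singleton_union]
      intro a ha b hb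
      obtain ⟨a₁, a₂, rfl⟩ := Submodule.mem_span_pair.1 ha
      obtain ⟨b₁, b₂, rfl⟩ := Submodule.mem_span_pair.1 hb
      have hyx : ⁅y, x⁆ = 0 := by rw [← lie_skew, hxy, neg_zero]
      simp [hxy, hyx]
  omega

end RealRank

/-! ### Abelian connected subgroups: differentials and unipotency -/

section AbelianImage

variable {d : ℕ} {N : Type*} [Group N] [TopologicalSpace N]
  [ChartedSpace (EuclideanSpace ℝ (Fin d)) N]

local notation "𝔽" => EuclideanSpace ℝ (Fin d)

variable {ι : N →* G} {A : EuclideanSpace ℝ (Fin d) →L[ℝ] EuclideanSpace ℝ (Fin m)}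

/-- Differentiate `g (ι y) g⁻¹ = ι y` at the identity. -/
theorem adOrbit_of_commute (hA : HasMFDerivAt (𝓡 d) (𝓡 m) ι 1 A) {g : G}
    (hg : ∀ y, g * ι y = ι y * g) (u : 𝔽) : adOrbit m (A u) g = A u := by
  have h1 : ∀ z : G, z = 1 → HasMFDerivAt (𝓡 m) (𝓡 m) (fun x : G => g * x * g⁻¹) z
      (Ad m g : 𝔼 →L[ℝ] 𝔼) := by
    rintro z rfl
    exact (mdifferentiableAt_conj g).hasMFDerivAt
  have h2 := HasMFDerivAt.comp (1 : N) (h1 _ (map_one ι)) hA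
  have h3 : (fun x : G => g * x * g⁻¹) ∘ ι = ι := by
    funext y
    simp only [Function.comp_apply]
    rw [hg, mul_inv_cancel_right]
  rw [h3] at h2
  exact DFunLike.congr_fun (hasMFDerivAt_unique h2 hA) u

theorem lie_eq_zero_of_commute (hA : HasMFDerivAt (𝓡 d) (𝓡 m) ι 1 A)
    (hab : ∀ x y, ι x * ι y = ι y * ι x) (v u : 𝔽) :
    (⁅(show LieAlg m G from A v), (show LieAlg m G from A u)⁆ : LieAlg m G) = 0 := by
  obtain ⟨D, hD, hd⟩ := hasMFDerivAt_comp_of_eq_one (map_one ι) hA (A u)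
  have h1 : (fun y => adOrbit m (A u) (ι y)) = fun _ => A u := by
    funext y
    exact adOrbit_of_commute hA (fun z => hab y z) u
  rw [h1] at hd
  have h2 := hasMFDerivAt_unique hd (hasMFDerivAt_const (A u) (1 : N))
  exact (hD v).symm.trans (DFunLike.congr_fun h2 v)

/-- Differentiate `Ad g ∘ Ad (ι y) = Ad (ι y) ∘ Ad g` in `y` at the identity. -/
theorem Ad_lie_of_commute (hA : HasMFDerivAt (𝓡 d) (𝓡 m) ι 1 A) {g : G}
    (hg : ∀ y, g * ι y = ι y * g) (u : 𝔽) (w : LieAlg m G) :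
    Ad m g ⁅(show LieAlg m G from A u), w⁆ = ⁅(show LieAlg m G from A u), Ad m g w⁆ := by
  obtain ⟨D₁, hD₁, hd₁⟩ := hasMFDerivAt_comp_of_eq_one (map_one ι) hA w
  obtain ⟨D₂, hD₂, hd₂⟩ := hasMFDerivAt_comp_of_eq_one (map_one ι) hA (Ad m g w)
  let T : 𝔼 →L[ℝ] 𝔼 := Ad m g
  have h1 : HasMFDerivAt (𝓡 d) 𝓘(ℝ, 𝔼) (T ∘ fun y => adOrbit m w (ι y)) 1 (T.comp D₁) :=
    HasMFDerivAt.comp (1 : N) T.hasMFDerivAt hd₁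
  have h2 : (T ∘ fun y => adOrbit m w (ι y)) = fun y => adOrbit m (Ad m g w) (ι y) := by
    funext y
    refine (adOrbit_mul g (ι y) w).symm.trans ?_
    rw [hg]
    exact adOrbit_mul (ι y) g w
  rw [h2] at h1
  have h3 := DFunLike.congr_fun (hasMFDerivAt_unique h1 hd₂) u
  exact (congrArg T (hD₁ u)).symm.trans (h3.trans (hD₂ u))

variable [LieGroup (𝓡 d) ∞ N]

/-- The derivative of the adjoint representation restricted to the image of `ι`. -/
theorem exists_hasMFDerivAt_adOrbit_comp (hA : HasMFDerivAt (𝓡 d) (𝓡 m) ι 1 A) (x : N) :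
    ∃ U : 𝔽 →L[ℝ] 𝔽, ∀ w : 𝔼, ∃ D : 𝔽 →L[ℝ] 𝔼,
      (∀ ξ, D ξ = Ad m (ι x) ⁅(show LieAlg m G from A (U ξ)), (show LieAlg m G from w)⁆) ∧
      HasMFDerivAt (𝓡 d) 𝓘(ℝ, 𝔼) (fun y => adOrbit m w (ι y)) x D := by
  have hs : ContMDiff (𝓡 d) (𝓡 d) ∞ (fun y : N => x⁻¹ * y) := contMDiff_const.mul contMDiff_id
  have hU := (hs.mdifferentiable (by simp) x).hasMFDerivAt
  -- Left translation moves the problem to the identity, through `Ad (ι y) = Ad (ι x) ∘ Ad (ι (x⁻¹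
  -- y))`.
  refine ⟨mfderiv (𝓡 d) (𝓡 d) (fun y : N => x⁻¹ * y) x, fun w => ?_⟩
  have h1 : ∀ z : N, z = 1 → HasMFDerivAt (𝓡 d) (𝓡 m) ι z A := by
    rintro z rfl; exact hA
  have h2 := HasMFDerivAt.comp x (h1 _ (inv_mul_cancel x)) hU
  obtain ⟨D, hD, hd⟩ := hasMFDerivAt_comp_of_eq_one (m := m) (G := G)
    (f := ι ∘ fun y : N => x⁻¹ * y) (x := x) (by simp) h2 w
  let T : 𝔼 →L[ℝ] 𝔼 := Ad m (ι x)
  refine ⟨T.comp D, fun ξ => congrArg T (hD ξ), ?_⟩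
  have h3 : HasMFDerivAt (𝓡 d) 𝓘(ℝ, 𝔼)
      (T ∘ fun y => adOrbit m w ((ι ∘ fun y : N => x⁻¹ * y) y)) x (T.comp D) :=
    HasMFDerivAt.comp x T.hasMFDerivAt hd
  have h4 : (T ∘ fun y => adOrbit m w ((ι ∘ fun y : N => x⁻¹ * y) y)) =
      fun y => adOrbit m w (ι y) := by
    funext y
    refine (adOrbit_mul (ι x) _ w).symm.trans ?_
    simp
  rwa [h4] at h3

/-- If all infinitesimal generators of an abelian connected subgroup are nilpotent, then the
trace of the adjoint representation is constant on it. -/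
theorem trace_Ad_eq [ConnectedSpace N] (hA : HasMFDerivAt (𝓡 d) (𝓡 m) ι 1 A)
    (hab : ∀ x y, ι x * ι y = ι y * ι x)
    (hnil : ∀ u, IsNilpotent (LieAlgebra.ad ℝ (LieAlg m G) (show LieAlg m G from A u))) (x y : N) :
    LinearMap.trace ℝ (LieAlg m G) (Ad m (ι x) : LieAlg m G →ₗ[ℝ] LieAlg m G) =
      LinearMap.trace ℝ (LieAlg m G) (Ad m (ι y) : LieAlg m G →ₗ[ℝ] LieAlg m G) := by
  have : IsManifold (𝓡 d) ∞ N := isManifold_infty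
  have : IsManifold (𝓡 d) 1 N := IsManifold.of_le (n := ∞) (by simp)
  let b := Module.finBasis ℝ (LieAlg m G)
  have htr : ∀ T : LieAlg m G →ₗ[ℝ] LieAlg m G,
      LinearMap.trace ℝ (LieAlg m G) T = ∑ i, b.coord i (T (b i)) := by
    intro T
    rw [LinearMap.trace_eq_matrix_trace ℝ b, Matrix.trace]
    simp only [Matrix.diag_apply, LinearMap.toMatrix_apply, Module.Basis.coord_apply]
  let c : ∀ i, 𝔼 →L[ℝ] ℝ := fun i =>
    LinearMap.toContinuousLinearMap (show 𝔼 →ₗ[ℝ] ℝ from b.coord i)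
  refine IsLocallyConstant.apply_eq_of_preconnectedSpace (f := fun x : N =>
    LinearMap.trace ℝ (LieAlg m G) (Ad m (ι x) : LieAlg m G →ₗ[ℝ] LieAlg m G))
    (isLocallyConstant_of_hasMFDerivAt_zero (d := d) fun x => ?_) x y
  obtain ⟨U, hU⟩ := exists_hasMFDerivAt_adOrbit_comp hA x
  choose D hD hd using hU
  have h1 : ∀ i, HasMFDerivAt (𝓡 d) 𝓘(ℝ, ℝ) (fun y => c i (adOrbit m (b i) (ι y))) x
      ((c i).comp (D (b i))) := fun i =>
    HasMFDerivAt.comp x (c i).hasMFDerivAt (hd (b i))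
  have h2 : HasMFDerivAt (𝓡 d) 𝓘(ℝ, ℝ) (∑ i, fun y => c i (adOrbit m (b i) (ι y))) x
      (∑ i, (c i).comp (D (b i)) : 𝔽 →L[ℝ] ℝ) := HasMFDerivAt.sum fun i _ => h1 i
  have h3 : (∑ i, (c i).comp (D (b i))) = 0 := by
    ext ξ
    rw [sum_apply]
    -- The derivative of the trace is the trace of `Ad (ι x) ∘ ad (A (U ξ))`; the factors commute
    -- and the second is nilpotent, so it vanishes.
    have hcomm : Commute ((Ad m (ι x) : LieAlg m G →ₗ[ℝ] LieAlg m G) : Module.End ℝ (LieAlg m G))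
        (LieAlgebra.ad ℝ (LieAlg m G) (show LieAlg m G from A (U ξ))) :=
      LinearMap.ext fun w => Ad_lie_of_commute hA (hab x) (U ξ) w
    have h4 := (LinearMap.isNilpotent_trace_of_isNilpotent
      (hcomm.isNilpotent_mul_left (hnil (U ξ)))).eq_zero
    rw [htr] at h4
    refine Eq.trans (Finset.sum_congr rfl fun i _ => ?_) h4
    exact congrArg (b.coord i) (hD (b i) ξ)
  have h5 : (∑ i, fun y => c i (adOrbit m (b i) (ι y))) = fun x : N =>
      LinearMap.trace ℝ (LieAlg m G) (Ad m (ι x) : LieAlg m G →ₗ[ℝ] LieAlg m G) := by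
    funext y
    rw [Finset.sum_apply]
    exact (htr _).symm
  rw [h5] at h2
  have h6 : ∀ E : 𝔽 →L[ℝ] ℝ, E = 0 → ∀ f : N → ℝ, HasMFDerivAt (𝓡 d) 𝓘(ℝ, ℝ) f x E →
      HasMFDerivAt (𝓡 d) 𝓘(ℝ, ℝ) f x (0 : 𝔽 →L[ℝ] ℝ) := by
    rintro _ rfl f hf
    exact hf
  exact h6 _ h3 _ h2

/-- An abelian connected subgroup with nilpotent infinitesimal generators is unipotent. -/
theorem isUnipotentElement_of_isNilpotent [ConnectedSpace N]
    (hA : HasMFDerivAt (𝓡 d) (𝓡 m) ι 1 A) (hab : ∀ x y, ι x * ι y = ι y * ι x)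
    (hnil : ∀ u, IsNilpotent (LieAlgebra.ad ℝ (LieAlg m G) (show LieAlg m G from A u))) (x : N) :
    IsUnipotentElement m (ι x) := by
  refine LinearMap.isNilpotent_sub_one_of_forall_trace_pow_eq _
    (LinearMap.trace ℝ (LieAlg m G) (Ad m (ι 1) : LieAlg m G →ₗ[ℝ] LieAlg m G)) fun k => ?_
  have hpow : (Ad m (ι x) : Module.End ℝ (LieAlg m G)) ^ k =
      (Ad m (ι (x ^ k)) : LieAlg m G →ₗ[ℝ] LieAlg m G) := by
    induction k with
    | zero => rw [pow_zero, pow_zero, map_one, Ad_one]; rfl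
    | succ k ih => rw [pow_succ, ih, pow_succ, map_mul, Ad_mul]; rfl
  rw [hpow]
  exact trace_Ad_eq hA hab hnil _ _

end AbelianImage

end RankOne

end

end

/-! ### The main theorem -/

theorem mainTheorem10 {m : ℕ} {G : Type*} [Group G] [TopologicalSpace G]
    [ChartedSpace (EuclideanSpace ℝ (Fin m)) G] [LieGroup (𝓡 m) ∞ G] [ConnectedSpace G]
    (hcenter : Subgroup.center G = ⊥)
    (hsimple : LieAlgebra.IsSimple ℝ (RankOne.LieAlg m G))
    (θ : RankOne.LieAlg m G ≃ₗ⁅ℝ⁆ RankOne.LieAlg m G)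
    (hθ : RankOne.IsCartanInvolution θ)
    (hrank : RankOne.realRank θ = 1)
    (hn : 4 ≤ RankOne.symmetricSpaceDim θ)
    (B : Subgroup G) (d : ℕ)
    (hB : RankOne.IsConnectedLieSubgroup m B d)
    (hab : ∀ x ∈ B, ∀ y ∈ B, x * y = y * x)
    (hunip : ¬ RankOne.IsUnipotentSubgroup m B) :
    d < RankOne.symmetricSpaceDim θ - 1 := by
  obtain ⟨N, _, _, _, _, _, ι, hsmooth, -, himm, rfl⟩ := hB
  let A : EuclideanSpace ℝ (Fin d) →L[ℝ] EuclideanSpace ℝ (Fin m) := mfderiv (𝓡 d) (𝓡 m) ι 1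
  have hA : HasMFDerivAt (𝓡 d) (𝓡 m) ι 1 A :=
    (hsmooth.mdifferentiable (by simp) 1).hasMFDerivAt
  have hcomm : ∀ x y, ι x * ι y = ι y * ι x := fun x y => hab _ ⟨x, rfl⟩ _ ⟨y, rfl⟩
  let A' : EuclideanSpace ℝ (Fin d) →ₗ[ℝ] RankOne.LieAlg m G := A.toLinearMap
  have hfin : Module.finrank ℝ (LinearMap.range A') = d := by
    have hinj : Function.Injective A' := himm 1
    rw [LinearMap.finrank_range_of_inj hinj, finrank_euclideanSpace_fin]
  have hnil : ∃ b ∈ LinearMap.range A', ¬ IsNilpotent (LieAlgebra.ad ℝ (RankOne.LieAlg m G) b) := by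
    by_contra hcon
    push Not at hcon
    refine hunip ?_
    rintro _ ⟨x, rfl⟩
    exact RankOne.isUnipotentElement_of_isNilpotent hA hcomm (fun u => hcon _ ⟨u, rfl⟩) x
  have key := finrank_le_of_lie_not_isNilpotent hsimple θ hθ.involutive hθ.pos
    (RankOne.exists_eq_smul_of_realRank hrank) (RankOne.exists_ne_zero_of_realRank hrank)
    (RankOne.cartanP θ) (fun _ => RankOne.mem_cartanP) (LinearMap.range A')
    (by
      rintro _ ⟨v, rfl⟩ _ ⟨u, rfl⟩
      exact RankOne.lie_eq_zero_of_commute hA hcomm v u) hnil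
  have hle := RankOne.finrank_cartanP_le θ hθ
  -- With `dim 𝔭 ≤ n` and `n ≥ 4`, both terms of the maximum are at most `n - 2`.
  omega
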